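/- Set $\hbar=1$ and let $\lambda,\mu>0$, $\kappa\in\mathbb R$. A system with Hilbert space $L^2(\mathbb R)$ (position $Q$, momentum $P$, coordinate $q$) is coupled to two probes with joint Hilbert space $L^2(\mathbb R^2)$ (coordinates $q_1,q_2$) by the unitary $U=e^{-iH}$ with $H=\lambda QP_1-\mu PQ_2+\tfrac{\lambda\mu}{2}\kappa P_1Q_2$, that is, $$(U\Phi)(q,q_1,q_2)=\Phi\bigl(q+\mu q_2,\;q_1-\lambda q-\tfrac{\lambda\mu}{2}(\kappa+1)q_2,\;q_2\bigr).$$ Let $\sigma$ be an arbitrary density operator on $L^2(\mathbb R^2)$ (the probe state; it may be pure or mixed, entangled or not). After the coupling, $Q_1$ and $P_2$ are measured ideally; the effective joint observable $G=G^{(\lambda,\mu)}$ of the system consists of the bounded operators $G(X\times Y)$, $X,Y\subseteq\mathbb R$ Borel, determined by $$\langle\psi,G(X\times Y)\psi\rangle=\operatorname{tr}\bigl[U(P_\psi\otimes\sigma)U^*\,(I\otimes \mathsf E^{Q_1}(\lambda X)\otimes \mathsf E^{P_2}(\mu Y))\bigr]\qquad(\|\psi\|=1),$$ where $P_\psi$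 is the projection onto $\psi$ and $\mathsf E^{A}$ denotes the spectral measure of $A$. Let $\mathsf E(X)=G(X\times\mathbb R)$ and $\mathsf F(Y)=G(\mathbb R\times Y)$ be its marginals. For a probability measure $m$ on $\mathbb R$ write $(\chi_X*m)(x)=m(\{y: x-y\in X\})$, let $m[2]=\int x^2\,dm(x)\in[0,\infty]$, and let $\operatorname{Var} m\in[0,\infty]$ be the variance of $m$. Then these operators $G(X\times Y)$ exist, and there are probability measures $e=e^{(\lambda,\mu)}$ and $f=f^{(\lambda,\mu)}$ on $\mathbb R$ (the noise distributions) with $$\mathsf E(X)=(\chi_X*e)(Q),\qquad \mathsf F(Y)=(\chi_Y*f)(P)\qquad\text{for all Borel sets }X,Y\subseteq\mathbb R,$$ and any such $e,f$ satisfy $$\operatorname{Var}e\cdot\operatorname{Var}f\ \ge\ \tfrac14\qquad\text{and}\qquad e[2]\cdot f[2]\ \ge\ \tfrac14 .$$ Consequently Heisenberg's error--disturbance (joint measurement error) relation is not violated in any generalized Arthurs--Kelly model: for observables $A,B$ on $\mathbb R$ let $\Delta(A,B)=\sup_\rho \mathcal D_2(p^A_\rho,p^B_\rho)\in[0,\infty]$,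 the supremum over all density operators $\rho$ on $L^2(\mathbb R)$ of the Wasserstein 2-distance between the outcome distributions $p^A_\rho(X)=\operatorname{tr}[\rho A(X)]$ and $p^B_\rho$. Then $$\Delta(\mathsf E,\mathsf E^Q)^2=e[2],\qquad \Delta(\mathsf F,\mathsf E^P)^2=f[2],\qquad \Delta(\mathsf E,\mathsf E^Q)\,\Delta(\mathsf F,\mathsf E^P)\ \ge\ \tfrac12 .$$ -/

import Mathlib

open MeasureTheory ProbabilityTheory Set
open scoped ENNReal FourierTransform InnerProductSpace

noncomputable section

namespace ArthursKelly

/-! ### Hilbert space operators, trace, states -/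

section Trace

variable (H : Type) [NormedAddCommGroup H] [InnerProductSpace ℂ H] [CompleteSpace H]

/-- Index set of a fixed orthonormal basis of the Hilbert space `H`. -/
def BasisIndex : Set H := (exists_hilbertBasis ℂ H).choose

/-- A fixed orthonormal (Hilbert) basis of `H`. -/
def onb : HilbertBasis (BasisIndex H) ℂ H := (exists_hilbertBasis ℂ H).choose_spec.choose

variable {H}

/-- The trace `∑ᵢ ⟨bᵢ, T bᵢ⟩`. It is only applied to products of a density operator and bounded
operators, where the sum converges absolutely and does not depend on the basis. -/
def trace (T : H →L[ℂ] H) : ℂ := ∑' i, ⟪onb H i, T (onb H i)⟫_ℂ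

variable (H) in
/-- A density operator: a positive operator with trace one. -/
structure DensityOperator where
  op : H →L[ℂ] H
  positive : op.IsPositive
  trace_one : HasSum (fun i => ⟪onb H i, op (onb H i)⟫_ℂ) 1

end Trace

/-! ### Wave functions, position and momentum -/

section Waves

variable (V : Type) [NormedAddCommGroup V] [InnerProductSpace ℝ V] [FiniteDimensional ℝ V]
  [MeasurableSpace V] [BorelSpace V]

/-- The Hilbert space of square-integrable wave functions on the configuration space `V`. -/
abbrev L2 : Type := Lp (α := V) ℂ 2 (volume : Measure V)

variable {V}

open Classical in
/-- The operator `g(Q)` of multiplication by an (essentially) bounded measurable function `g` in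
the position representation (and `0` if `g` is not such a function). -/
def posFun (g : V → ℂ) : L2 V →L[ℂ] L2 V :=
  if h : MemLp g ∞ (volume : Measure V) then
    (ContinuousLinearMap.mul ℂ ℂ).holderL volume ∞ 2 2 (h.toLp g)
  else 0

/-- The unitary Fourier transform with kernel `exp (-2πi⟨x, ξ⟩)` on square-integrable functions. -/
def fourierOp : L2 V →L[ℂ] L2 V :=
  (Lp.fourierTransformₗᵢ V ℂ).toContinuousLinearEquiv.toContinuousLinearMap

/-- The inverse Fourier transform on square-integrable functions. -/
def fourierInvOp : L2 V →L[ℂ] L2 V :=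
  (Lp.fourierTransformₗᵢ V ℂ).symm.toContinuousLinearEquiv.toContinuousLinearMap

/-- The operator `g(P)`, where `P = -i∇` is the momentum (`ℏ = 1`). In the normalisation of the
Fourier transform used here, the momentum belonging to the frequency `ξ` is `p = 2πξ`. -/
def momFun (g : V → ℂ) : L2 V →L[ℂ] L2 V :=
  fourierInvOp ∘L posFun (fun ξ => g ((2 * Real.pi) • ξ)) ∘L fourierOp

end Waves

/-- The indicator function of a set, with complex values. -/
def chi {V : Type} (A : Set V) : V → ℂ := A.indicator 1

/-- The ideal position observable (spectral measure of `Q`) of one particle on the line. -/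
def idealPosition (X : Set ℝ) : L2 ℝ →L[ℂ] L2 ℝ := posFun (chi X)

/-- The ideal momentum observable (spectral measure of `P`) of one particle on the line. -/
def idealMomentum (Y : Set ℝ) : L2 ℝ →L[ℂ] L2 ℝ := momFun (chi Y)

/-- The configuration space of the two probes, with coordinates `(q₁, q₂)`. -/
abbrev ProbeConf : Type := EuclideanSpace ℝ (Fin 2)

/-- The configuration space of system and probes, with coordinates `(q, q₁, q₂)`. -/
abbrev TotalConf : Type := EuclideanSpace ℝ (Fin 3)

/-- The spectral measure of the position `Q₁` of probe 1, on the total system. -/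
def probePosition (X : Set ℝ) : L2 TotalConf →L[ℂ] L2 TotalConf :=
  posFun (chi {x : TotalConf | x 1 ∈ X})

/-- The spectral measure of the momentum `P₂` of probe 2, on the total system. -/
def probeMomentum (Y : Set ℝ) : L2 TotalConf →L[ℂ] L2 TotalConf :=
  momFun (chi {p : TotalConf | p 2 ∈ Y})

/-! ### Product states -/

/-- Splitting of the coordinates `(q, q₁, q₂)` into `q` and `(q₁, q₂)`. -/
def splitConf (x : TotalConf) : ℝ × ProbeConf := (x 0, !₂[x 1, x 2])

theorem measurePreserving_splitConf :
    MeasurePreserving splitConf (volume : Measure TotalConf) (volume : Measure (ℝ × ProbeConf)) := by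
  have h1 := PiLp.volume_preserving_ofLp (Fin 3)
  have h2 := volume_preserving_piFinSuccAbove (fun _ : Fin 3 => ℝ) 0
  have h3 : MeasurePreserving (Prod.map (id : ℝ → ℝ) (WithLp.toLp 2 : (Fin 2 → ℝ) → ProbeConf))
      volume volume := (MeasurePreserving.id volume).prod (PiLp.volume_preserving_toLp (Fin 2))
  have h4 : splitConf = Prod.map (id : ℝ → ℝ) (WithLp.toLp 2 : (Fin 2 → ℝ) → ProbeConf) ∘
      (MeasurableEquiv.piFinSuccAbove (fun _ : Fin 3 => ℝ) 0) ∘ WithLp.ofLp := by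
    funext x
    refine Prod.ext rfl ?_
    ext i
    fin_cases i <;> rfl
  rw [h4]
  exact h3.comp (h2.comp h1)

theorem eLpNorm_tensor (ψ : L2 ℝ) (φ : L2 ProbeConf) :
    eLpNorm (fun x : TotalConf => ψ (splitConf x).1 * φ (splitConf x).2) 2 volume =
      eLpNorm ψ 2 volume * eLpNorm φ 2 volume := by
  have hψ := (Lp.aestronglyMeasurable ψ)
  have hφ := (Lp.aestronglyMeasurable φ)
  have hm : AEStronglyMeasurable (fun z : ℝ × ProbeConf => ψ z.1 * φ z.2) volume :=
    hψ.comp_fst.mul hφ.comp_snd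
  have h1 := eLpNorm_comp_measurePreserving (p := 2) hm measurePreserving_splitConf
  have h2 : (fun x : TotalConf => ψ (splitConf x).1 * φ (splitConf x).2) =
      (fun z : ℝ × ProbeConf => ψ z.1 * φ z.2) ∘ splitConf := rfl
  rw [h2, h1]
  simp only [eLpNorm_eq_lintegral_rpow_enorm_toReal two_ne_zero ENNReal.ofNat_ne_top]
  rw [← ENNReal.mul_rpow_of_nonneg _ _ (by positivity), Measure.volume_eq_prod,
    ← lintegral_prod_mul (hψ.enorm.pow_const _) (hφ.enorm.pow_const _)]
  congr 1
  refine lintegral_congr fun z => ?_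
  rw [enorm_mul, ENNReal.mul_rpow_of_nonneg _ _ (by positivity)]

theorem memLp_tensor (ψ : L2 ℝ) (φ : L2 ProbeConf) :
    MemLp (fun x : TotalConf => ψ (splitConf x).1 * φ (splitConf x).2) 2 volume := by
  refine ⟨?_, ?_⟩
  · have hm : AEStronglyMeasurable (fun z : ℝ × ProbeConf => ψ z.1 * φ z.2) volume :=
      (Lp.aestronglyMeasurable ψ).comp_fst.mul (Lp.aestronglyMeasurable φ).comp_snd
    exact hm.comp_measurePreserving measurePreserving_splitConf
  · rw [eLpNorm_tensor]
    exact ENNReal.mul_lt_top (Lp.memLp ψ).2 (Lp.memLp φ).2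

/-- The product wave function `(ψ ⊗ φ)(q, q₁, q₂) = ψ(q) φ(q₁, q₂)`. -/
def tensor (ψ : L2 ℝ) (φ : L2 ProbeConf) : L2 TotalConf := (memLp_tensor ψ φ).toLp _

theorem norm_tensor (ψ : L2 ℝ) (φ : L2 ProbeConf) : ‖tensor ψ φ‖ = ‖ψ‖ * ‖φ‖ := by
  rw [tensor, Lp.norm_toLp, eLpNorm_tensor, ENNReal.toReal_mul, ← Lp.norm_def, ← Lp.norm_def]

theorem tendsto_snd_splitConf :
    Filter.Tendsto (fun x : TotalConf => (splitConf x).2) (ae volume) (ae volume) :=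
  Measure.quasiMeasurePreserving_snd.tendsto_ae.comp
    measurePreserving_splitConf.quasiMeasurePreserving.tendsto_ae

/-- The bounded operator `φ ↦ ψ ⊗ φ`. -/
def tensorLeft (ψ : L2 ℝ) : L2 ProbeConf →L[ℂ] L2 TotalConf :=
  LinearMap.mkContinuous
    { toFun := tensor ψ
      map_add' := fun φ₁ φ₂ => by
        rw [tensor, tensor, tensor, ← MemLp.toLp_add]
        apply MemLp.toLp_congr
        filter_upwards [tendsto_snd_splitConf.eventually (Lp.coeFn_add φ₁ φ₂)] with x hx
        simp only [hx, Pi.add_apply, mul_add]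
      map_smul' := fun c φ => by
        rw [tensor, tensor, RingHom.id_apply, ← MemLp.toLp_const_smul]
        apply MemLp.toLp_congr
        filter_upwards [tendsto_snd_splitConf.eventually (Lp.coeFn_smul c φ)] with x hx
        simp only [hx, Pi.smul_apply, smul_eq_mul, mul_left_comm] }
    ‖ψ‖ (fun φ => (norm_tensor ψ φ).le)

/-- The operator `P_ψ ⊗ σ` on the total system, where `P_ψ` is the projection onto the unit
vector `ψ` of the system. -/
def productState (ψ : L2 ℝ) (σ : L2 ProbeConf →L[ℂ] L2 ProbeConf) :
    L2 TotalConf →L[ℂ] L2 TotalConf :=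
  tensorLeft ψ ∘L σ ∘L (tensorLeft ψ).adjoint

/-! ### The coupling -/

/-- The flow on configuration space that is induced by the interaction Hamiltonian
`H = λ Q P₁ - μ P Q₂ + (λμκ/2) P₁ Q₂`. -/
def couplingFlow (lam mu kap t : ℝ) (x : TotalConf) : TotalConf :=
  !₂[x 0 + t * mu * x 2,
    x 1 - t * lam * x 0 - (t ^ 2 * (lam * mu / 2) + t * (lam * mu / 2 * kap)) * x 2,
    x 2]

theorem couplingFlow_zero (lam mu kap : ℝ) (x : TotalConf) :
    couplingFlow lam mu kap 0 x = x := by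
  ext i; fin_cases i <;> simp [couplingFlow]

theorem couplingFlow_add (lam mu kap s t : ℝ) (x : TotalConf) :
    couplingFlow lam mu kap (s + t) x = couplingFlow lam mu kap s (couplingFlow lam mu kap t x) := by
  ext i; fin_cases i <;> simp [couplingFlow] <;> ring

/-- The matrix of the linear map `couplingFlow lam mu kap t`. -/
def couplingMatrix (lam mu kap t : ℝ) : Matrix (Fin 3) (Fin 3) ℝ :=
  !![1, 0, t * mu;
    -(t * lam), 1, -(t ^ 2 * (lam * mu / 2) + t * (lam * mu / 2 * kap));
    0, 0, 1]

theorem couplingFlow_eq_toLpLin (lam mu kap t : ℝ) :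
    couplingFlow lam mu kap t = Matrix.toLpLin 2 2 (couplingMatrix lam mu kap t) := by
  funext x
  ext i
  fin_cases i <;>
    simp [couplingFlow, couplingMatrix, Matrix.toLpLin_apply, dotProduct, Fin.sum_univ_three]
  ring

/-- The interaction Hamiltonian `H = λ Q P₁ - μ P Q₂ + (λμκ/2) P₁ Q₂`, with `P = -i ∂/∂q` and
`P₁ = -i ∂/∂q₁`, as a differential operator. -/
def hamiltonian (lam mu kap : ℝ) (Φ : TotalConf → ℂ) (x : TotalConf) : ℂ :=
  lam * x 0 * (-Complex.I * fderiv ℝ Φ x (EuclideanSpace.single 1 1))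
    - mu * x 2 * (-Complex.I * fderiv ℝ Φ x (EuclideanSpace.single 0 1))
    + lam * mu / 2 * kap * x 2 * (-Complex.I * fderiv ℝ Φ x (EuclideanSpace.single 1 1))

/-- The functions `Φ_t = Φ ∘ couplingFlow t` solve the Schrödinger equation `dΦ_t/dt = -i H Φ_t`
with initial value `Φ`: composition with the flow is the unitary group `exp(-itH)`. -/
theorem schrodinger_couplingFlow (lam mu kap t : ℝ) (Φ : TotalConf → ℂ) (hΦ : Differentiable ℝ Φ)
    (x : TotalConf) :
    HasDerivAt (fun s => Φ (couplingFlow lam mu kap s x))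
      (-Complex.I * hamiltonian lam mu kap (fun y => Φ (couplingFlow lam mu kap t y)) x) t := by
  set L : TotalConf →L[ℝ] TotalConf :=
    (Matrix.toLpLin 2 2 (couplingMatrix lam mu kap t)).toContinuousLinearMap with hL
  have hLf : ∀ y, couplingFlow lam mu kap t y = L y := fun y => by
    rw [couplingFlow_eq_toLpLin, hL]; rfl
  set v : TotalConf := (mu * x 2) • EuclideanSpace.single 0 1
    - (lam * x 0 + lam * mu / 2 * kap * x 2) • EuclideanSpace.single 1 1 with hv
  have hcurve : HasDerivAt (fun s => couplingFlow lam mu kap s x) (L v) t := by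
    have h1 : (fun s => couplingFlow lam mu kap s x) = fun s : ℝ =>
        x + s • v + s ^ 2 • ((-(lam * mu / 2 * x 2)) • (EuclideanSpace.single 1 1 : TotalConf)) := by
      funext s
      ext i
      fin_cases i <;> simp [couplingFlow, hv]
      all_goals ring
    have h2 : L v = (1 : ℝ) • v + (((2 : ℕ) : ℝ) * t ^ (2 - 1)) •
        ((-(lam * mu / 2 * x 2)) • (EuclideanSpace.single 1 1 : TotalConf)) := by
      rw [← hLf]
      ext i
      fin_cases i <;> simp [couplingFlow, hv]
      all_goals ring
    rw [h1, h2]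
    exact (((hasDerivAt_id t).smul_const v).const_add x).add ((hasDerivAt_pow 2 t).smul_const _)
  have hΦx : HasFDerivAt Φ (fderiv ℝ Φ (couplingFlow lam mu kap t x))
      (couplingFlow lam mu kap t x) := (hΦ _).hasFDerivAt
  have h3 := hΦx.comp_hasDerivAt t hcurve
  have h4 : fderiv ℝ (fun y => Φ (couplingFlow lam mu kap t y)) x =
      (fderiv ℝ Φ (couplingFlow lam mu kap t x)).comp L := by
    have h5 : HasFDerivAt (couplingFlow lam mu kap t) L x := by
      rw [show couplingFlow lam mu kap t = L from funext hLf]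
      exact L.hasFDerivAt
    exact (hΦx.comp x h5).fderiv
  refine h3.congr_deriv ?_
  symm
  simp only [hamiltonian, h4, hv]
  simp only [ContinuousLinearMap.comp_apply, map_sub, map_smul, Complex.real_smul]
  push_cast
  linear_combination (-(lam * x 0 + lam * mu / 2 * kap * x 2) *
    fderiv ℝ Φ (couplingFlow lam mu kap t x) (L (EuclideanSpace.single 1 1))
    + mu * x 2 * fderiv ℝ Φ (couplingFlow lam mu kap t x) (L (EuclideanSpace.single 0 1)))
    * (-Complex.I_mul_I)

theorem measurePreserving_couplingFlow (lam mu kap t : ℝ) :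
    MeasurePreserving (couplingFlow lam mu kap t) (volume : Measure TotalConf) volume := by
  have hdet : LinearMap.det (Matrix.toLpLin 2 2 (couplingMatrix lam mu kap t)) = 1 := by
    rw [LinearMap.det_toLpLin, couplingMatrix, Matrix.det_fin_three]
    simp
  rw [couplingFlow_eq_toLpLin]
  refine ⟨(LinearMap.continuous_of_finiteDimensional _).measurable, ?_⟩
  rw [Measure.map_linearMap_addHaar_eq_smul_addHaar _ (by rw [hdet]; exact one_ne_zero), hdet]
  simp

/-- The unitary coupling `U = exp(-iH)` of the system with the probes:
`(U Φ)(q, q₁, q₂) = Φ(q + μ q₂, q₁ - λ q - (λμ/2)(κ + 1) q₂, q₂)`. -/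
def coupling (lam mu kap : ℝ) : L2 TotalConf →L[ℂ] L2 TotalConf :=
  (Lp.compMeasurePreservingₗᵢ ℂ (couplingFlow lam mu kap 1)
    (measurePreserving_couplingFlow lam mu kap 1)).toContinuousLinearMap

/-! ### The measured observable and its noise -/

/-- `G X Y` is the effect `G(X × Y)` of the phase space observable that the generalized
Arthurs-Kelly model measures on the system if the probes are prepared in the state `σ`:
`⟨ψ, G(X × Y) ψ⟩ = tr[U (P_ψ ⊗ σ) U* (I ⊗ E^{Q₁}(λX) ⊗ E^{P₂}(μY))]`
for all system states `ψ` and all Borel sets `X`, `Y` of rescaled pointer readings. -/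
def IsEffectiveObservable (lam mu kap : ℝ) (σ : DensityOperator (L2 ProbeConf))
    (G : Set ℝ → Set ℝ → (L2 ℝ →L[ℂ] L2 ℝ)) : Prop :=
  ∀ X Y : Set ℝ, MeasurableSet X → MeasurableSet Y → ∀ ψ : L2 ℝ, ‖ψ‖ = 1 →
    ⟪ψ, G X Y ψ⟫_ℂ =
      trace ((coupling lam mu kap ∘L productState ψ σ.op ∘L (coupling lam mu kap).adjoint) ∘L
        (probePosition ((fun x => lam * x) '' X) ∘L probeMomentum ((fun y => mu * y) '' Y)))

/-- The convolution `(χ_X * m)(x) = ∫ χ_X(x - y) dm(y)` of an indicator function with a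
probability measure. -/
def smear (m : Measure ℝ) (X : Set ℝ) : ℝ → ℂ := fun x => (m.real {y | x - y ∈ X} : ℂ)

/-- `e` is the noise distribution of the approximate position observable `E`:
`E(X) = (χ_X * e)(Q)`. -/
def IsPositionNoise (E : Set ℝ → (L2 ℝ →L[ℂ] L2 ℝ)) (e : Measure ℝ) : Prop :=
  IsProbabilityMeasure e ∧ ∀ X, MeasurableSet X → E X = posFun (smear e X)

/-- `f` is the noise distribution of the approximate momentum observable `F`:
`F(Y) = (χ_Y * f)(P)`. -/
def IsMomentumNoise (F : Set ℝ → (L2 ℝ →L[ℂ] L2 ℝ)) (f : Measure ℝ) : Prop :=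
  IsProbabilityMeasure f ∧ ∀ Y, MeasurableSet Y → F Y = momFun (smear f Y)

/-- The second moment `m[2] = ∫ x² dm(x)`, possibly infinite. -/
def secondMoment (m : Measure ℝ) : ℝ≥0∞ := ∫⁻ x, ENNReal.ofReal (x ^ 2) ∂m

/-! ### Operational error -/

/-- The Wasserstein 2-distance of two probability measures on the line, possibly infinite. -/
def wasserstein (α β : Measure ℝ) : ℝ≥0∞ :=
  ⨅ (γ : Measure (ℝ × ℝ)) (_ : γ.map Prod.fst = α ∧ γ.map Prod.snd = β),
    (∫⁻ z, ENNReal.ofReal (|z.1 - z.2| ^ 2) ∂γ) ^ (1 / 2 : ℝ)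

/-- `α` is the distribution of the outcomes of the observable `A` in the state `ρ`. -/
def IsOutcomeLaw (A : Set ℝ → (L2 ℝ →L[ℂ] L2 ℝ)) (ρ : DensityOperator (L2 ℝ))
    (α : Measure ℝ) : Prop :=
  IsProbabilityMeasure α ∧ ∀ X, MeasurableSet X → trace (ρ.op ∘L A X) = (α.real X : ℂ)

/-- The error `Δ(A, B)` of an observable `A` as an approximation of an observable `B`: the
Wasserstein 2-distance of their outcome distributions, maximised over all states. -/
def observableError (A B : Set ℝ → (L2 ℝ →L[ℂ] L2 ℝ)) : ℝ≥0∞ :=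
  ⨆ (ρ : DensityOperator (L2 ℝ)) (α : Measure ℝ) (β : Measure ℝ)
    (_ : IsOutcomeLaw A ρ α ∧ IsOutcomeLaw B ρ β), wasserstein α β

end ArthursKelly

end

noncomputable section

namespace ArthursKelly

/-! ### Traces and vector decompositions of density operators. -/

section TraceFormulas

/-! In the Heisenberg picture the coupling turns the rescaled pointers into `Q₁/λ ↦ Q + N` and `P₂/μ
↦ P + M`, where `N = Q₁/λ + (μ/2)(κ-1)Q₂` and `M = P₂/μ - (λ/2)(κ+1)P₁` act on the probes alone.
System and probes start in a product state, so the readings are those of `Q` and `P` with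
independent noise added. Since `smear` subtracts, `e` and `f` are the laws of `-N` and `-M` in the
state `σ`. The pointers commute, so the commutator of `N` and `M` must cancel that of `Q` and `P`:
the coefficient vectors have inner product `-1` for every `κ` (`inner_noisePosVec_noiseMomVec`). The
claimed bounds are therefore the ordinary uncertainty relation for `N` and `M` in the probe state.

On wave functions, the final state is the product state composed with a linear flow, and its Fourier
transform is the transformed product composed with the inverse transpose of that flow
(`map_density_finalState`, `map_density_fourierOp_finalState`). This gives existence of `e` and `f`.
They are unique because a multiplication operator determines its function almost everywhere
(`eq_of_posFun_smear_eq`), so it suffices to treat these explicit measures.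

A mixed `σ` is a sum `∑ᵢ |φᵢ⟩⟨φᵢ|`. The vector inequality `uncertainty`, with arbitrary centres, is
summed over `i` by Cauchy–Schwarz in `noise_uncertainty`. Centres at the means give the variances,
centres at `0` the second moments.

The operational error equals the root of the noise's second moment (`observableError_eq`): adding
the noise is itself a transport plan, and on states with outcomes concentrated near `0` no plan does
appreciably better. -/

theorem summable_norm_map_sq {H K : Type*} [NormedAddCommGroup H] [InnerProductSpace ℂ H]
    [NormedAddCommGroup K] [InnerProductSpace ℂ K] {ι : Type*} {φ : ι → H} (hφ : Summable fun i => ‖φ i‖ ^ 2) (A : H →L[ℂ] K) :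
    Summable fun i => ‖A (φ i)‖ ^ 2 := by
  refine Summable.of_nonneg_of_le (fun i => by positivity) (fun i => ?_) (hφ.mul_left (‖A‖ ^ 2))
  rw [← mul_pow]
  exact pow_le_pow_left₀ (norm_nonneg _) (A.le_opNorm _) 2

variable {H : Type} [NormedAddCommGroup H] [InnerProductSpace ℂ H] [CompleteSpace H]

/-- A density operator is a sum `∑ᵢ |φᵢ⟩⟨φᵢ|` with `∑ᵢ ‖φᵢ‖² = 1`. -/
theorem DensityOperator.exists_hasSum (ρ : DensityOperator H) :
    ∃ φ : BasisIndex H → H, HasSum (fun i => ‖φ i‖ ^ 2) 1 ∧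
      ∀ x, HasSum (fun i => ⟪φ i, x⟫_ℂ • φ i) (ρ.op x) := by
  have hnn : 0 ≤ ρ.op := (ContinuousLinearMap.nonneg_iff_isPositive _).2 ρ.positive
  set S : H →L[ℂ] H := CFC.sqrt ρ.op with hS
  have hSS : ∀ x, S (S x) = ρ.op x := fun x => by
    have := CFC.sqrt_mul_sqrt_self ρ.op hnn
    exact congrArg (fun T : H →L[ℂ] H => T x) this
  have hSpos : S.IsPositive := (ContinuousLinearMap.nonneg_iff_isPositive _).1 (CFC.sqrt_nonneg _)
  have hadj : ∀ x y, ⟪S x, y⟫_ℂ = ⟪x, S y⟫_ℂ := fun x y => hSpos.isSymmetric x y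
  -- The vectors are `√ρ bᵢ`. Their squared norms sum to the trace, and applying `√ρ` to the basis
  -- expansion of `√ρ x` gives `ρ x`.
  refine ⟨fun i => S (onb H i), ?_, fun x => ?_⟩
  · have h := ρ.trace_one
    have h2 : (fun i => ⟪onb H i, ρ.op (onb H i)⟫_ℂ) =
        fun i => ((‖S (onb H i)‖ ^ 2 : ℝ) : ℂ) := by
      funext i
      rw [← hSS, ← hadj, inner_self_eq_norm_sq_to_K]
      push_cast
      rfl
    rw [h2] at h
    exact Complex.hasSum_ofReal.1 (by simpa only [Complex.ofReal_one] using h)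
  · have h := ((onb H).hasSum_repr (S x)).mapL S
    rw [hSS] at h
    convert! h using 2 with i
    rw [map_smul, (onb H).repr_apply_apply, hadj]

/-- A summable family has countable support, so the zero vectors can be dropped. Countability is
what later allows sums over `i` to be exchanged with integrals. -/
theorem DensityOperator.exists_countable_hasSum (ρ : DensityOperator H) :
    ∃ (ι : Type) (_ : Countable ι) (φ : ι → H), HasSum (fun i => ‖φ i‖ ^ 2) 1 ∧
      ∀ x, HasSum (fun i => ⟪φ i, x⟫_ℂ • φ i) (ρ.op x) := by
  obtain ⟨φ, h1, h2⟩ := ρ.exists_hasSum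
  have hsub : ∀ {i}, i ∉ Function.support (fun i => ‖φ i‖ ^ 2) → φ i = 0 := fun {i} hi => by
    simpa using hi
  refine ⟨Function.support (fun i => ‖φ i‖ ^ 2), h1.summable.countable_support.to_subtype,
    fun i => φ i, (hasSum_subtype_iff_of_support_subset subset_rfl).2 h1, fun x => ?_⟩
  refine (hasSum_subtype_iff_of_support_subset (f := fun i => ⟪φ i, x⟫_ℂ • φ i) ?_).2 (h2 x)
  intro i hi
  by_contra h
  exact hi (by simp [hsub h])

theorem hasSum_norm_inner_sq (x : H) :
    HasSum (fun n => ‖⟪onb H n, x⟫_ℂ‖ ^ 2) (‖x‖ ^ 2) := by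
  have h := (onb H).hasSum_inner_mul_inner x x
  have h2 : (fun n => ⟪x, onb H n⟫_ℂ * ⟪onb H n, x⟫_ℂ) =
      fun n => ((‖⟪onb H n, x⟫_ℂ‖ ^ 2 : ℝ) : ℂ) := by
    funext n
    rw [← inner_conj_symm x, RCLike.conj_mul]
    push_cast
    rfl
  rw [h2, inner_self_eq_norm_sq_to_K, ← RCLike.ofReal_pow] at h
  exact Complex.hasSum_ofReal.1 h

theorem summable_norm_inner_sq {ι : Type*} {u : ι → H} (hu : Summable fun i => ‖u i‖ ^ 2) :
    Summable fun p : ι × BasisIndex H => ‖⟪onb H p.2, u p.1⟫_ℂ‖ ^ 2 := by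
  rw [summable_prod_of_nonneg fun p => by positivity]
  refine ⟨fun i => (hasSum_norm_inner_sq (u i)).summable, ?_⟩
  simpa only [(hasSum_norm_inner_sq _).tsum_eq] using hu

/-- The trace of the trace class operator `∑ᵢ |uᵢ⟩⟨vᵢ|` is `∑ᵢ ⟨vᵢ, uᵢ⟩`. -/
theorem hasSum_trace {ι : Type*} {T : H →L[ℂ] H} {u v : ι → H}
    (hu : Summable fun i => ‖u i‖ ^ 2) (hv : Summable fun i => ‖v i‖ ^ 2)
    (hT : ∀ x, HasSum (fun i => ⟪v i, x⟫_ℂ • u i) (T x)) :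
    HasSum (fun i => ⟪v i, u i⟫_ℂ) (trace T) := by
  have hsum : Summable fun p : ι × BasisIndex H =>
      ⟪v p.1, onb H p.2⟫_ℂ * ⟪onb H p.2, u p.1⟫_ℂ := by
    -- The bound `|ab| ≤ |a|² + |b|²` gives absolute summability of the double family, hence the
    -- exchange of the basis sum with the sum over `i`.
    refine Summable.of_norm_bounded
      ((summable_norm_inner_sq hv).add (summable_norm_inner_sq hu)) fun p => ?_
    rw [norm_mul, norm_inner_symm]
    nlinarith [sq_nonneg (‖⟪onb H p.2, v p.1⟫_ℂ‖ - ‖⟪onb H p.2, u p.1⟫_ℂ‖),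
      sq_nonneg (‖⟪onb H p.2, v p.1⟫_ℂ‖ + ‖⟪onb H p.2, u p.1⟫_ℂ‖)]
  have h1 : ∀ n, ⟪onb H n, T (onb H n)⟫_ℂ =
      ∑' i, ⟪v i, onb H n⟫_ℂ * ⟪onb H n, u i⟫_ℂ := fun n => by
    have h := (hT (onb H n)).mapL (innerSL ℂ (onb H n))
    simp only [innerSL_apply_apply, inner_smul_right] at h
    exact h.tsum_eq.symm
  have h2 : ∀ i, HasSum (fun n => ⟪v i, onb H n⟫_ℂ * ⟪onb H n, u i⟫_ℂ) ⟪v i, u i⟫_ℂ :=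
    fun i => (onb H).hasSum_inner_mul_inner _ _
  have h3 : trace T = ∑' p : ι × BasisIndex H,
      ⟪v p.1, onb H p.2⟫_ℂ * ⟪onb H p.2, u p.1⟫_ℂ := by
    rw [trace, hsum.tsum_prod, ← Summable.tsum_comm (f := fun i n =>
      ⟪v i, onb H n⟫_ℂ * ⟪onb H n, u i⟫_ℂ) hsum]
    exact tsum_congr h1
  rw [h3]
  exact hsum.hasSum.prod_fiberwise h2

/-- The pure state given by a unit vector. -/
def pureState (ψ : H) (hψ : ‖ψ‖ = 1) : DensityOperator H where
  op := InnerProductSpace.rankOne ℂ ψ ψ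
  positive := InnerProductSpace.isPositive_rankOne_self ψ
  trace_one := by
    have h := (onb H).hasSum_inner_mul_inner ψ ψ
    rw [inner_self_eq_norm_sq_to_K, hψ] at h
    simpa [InnerProductSpace.rankOne_apply, inner_smul_right] using h

theorem trace_pureState_comp (ψ : H) (hψ : ‖ψ‖ = 1) (B : H →L[ℂ] H) :
    trace ((pureState ψ hψ).op ∘L B) = ⟪ψ, B ψ⟫_ℂ := by
  have h := hasSum_trace (ι := Unit) (T := (pureState ψ hψ).op ∘L B) (u := fun _ => ψ)
    (v := fun _ => B.adjoint ψ) (Summable.of_finite) (Summable.of_finite) (fun x => by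
      convert! hasSum_fintype (α := H) (fun _ : Unit => _) using 1
      simp [pureState, ContinuousLinearMap.adjoint_inner_left])
  simpa [ContinuousLinearMap.adjoint_inner_left] using h.unique (hasSum_fintype _)

/-- The operator under the trace is `∑ᵢ |Aφᵢ⟩⟨B*Aφᵢ|`, so `hasSum_trace` applies. With `A = U(ψ ⊗
·)` this computes pointer statistics, with `A = id` outcome laws of mixed states. -/
theorem hasSum_trace_conj_comp {K : Type} [NormedAddCommGroup K] [InnerProductSpace ℂ K]
    [CompleteSpace K] {ι : Type*} {σ : H →L[ℂ] H} {φ : ι → H}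
    (hφ : Summable fun i => ‖φ i‖ ^ 2) (hσ : ∀ x, HasSum (fun i => ⟪φ i, x⟫_ℂ • φ i) (σ x))
    (A : H →L[ℂ] K) (B : K →L[ℂ] K) :
    HasSum (fun i => ⟪A (φ i), B (A (φ i))⟫_ℂ) (trace ((A ∘L σ ∘L A.adjoint) ∘L B)) := by
  have h := hasSum_trace (T := (A ∘L σ ∘L A.adjoint) ∘L B) (u := fun i => A (φ i))
    (v := fun i => (B.adjoint ∘L A) (φ i)) (summable_norm_map_sq hφ A)
    (summable_norm_map_sq hφ _) (fun x => by
      have h := (hσ (A.adjoint (B x))).mapL A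
      simpa [ContinuousLinearMap.adjoint_inner_left, ContinuousLinearMap.adjoint_inner_right]
        using h)
  simpa [ContinuousLinearMap.adjoint_inner_left] using h

end TraceFormulas

/-! ### Born rule: expectations of functions of `Q` and `P` as integrals. -/

section Densities

/-- Change of variables; it transports `|Φ|²` along the coordinate splitting and the two linear
flows. -/
theorem map_withDensity_of_comp {α β : Type*} [MeasurableSpace α] [MeasurableSpace β]
    {μ : Measure α} {ν : Measure β} {T : α → β} (hT : MeasurePreserving T μ ν)
    {f : α → ℝ≥0∞} {g : β → ℝ≥0∞} (hg : AEMeasurable g ν) (h : f =ᵐ[μ] g ∘ T) :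
    (μ.withDensity f).map T = ν.withDensity g := by
  ext A hA
  rw [Measure.map_apply hT.measurable hA, withDensity_apply _ hA,
    withDensity_apply _ (hT.measurable hA), lintegral_congr_ae (ae_restrict_of_ae h),
    ← (hT.restrict_preimage hA).map_eq, lintegral_map' _ hT.measurable.aemeasurable]
  · rfl
  · rw [(hT.restrict_preimage hA).map_eq]
    exact hg.restrict

variable {V : Type} [NormedAddCommGroup V] [InnerProductSpace ℝ V] [FiniteDimensional ℝ V]
  [MeasurableSpace V] [BorelSpace V]

theorem coeFn_posFun {g : V → ℂ} (hg : MemLp g ∞ (volume : Measure V)) (ψ : L2 V) :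
    posFun g ψ =ᵐ[volume] fun x => g x * ψ x := by
  rw [posFun, dif_pos hg, ContinuousLinearMap.holderL_apply_apply]
  filter_upwards [ContinuousLinearMap.coeFn_holder (r := 2) (ContinuousLinearMap.mul ℂ ℂ)
    (hg.toLp g) ψ, hg.coeFn_toLp] with x h1 h2
  rw [h1, h2, ContinuousLinearMap.mul_apply']

/-- The probability density `|ψ|²` of the position in the state `ψ`, as a measure. -/
def density (ψ : L2 V) : Measure V := volume.withDensity fun x => ‖ψ x‖ₑ ^ 2

theorem aemeasurable_enorm_sq (ψ : L2 V) : AEMeasurable (fun x => ‖ψ x‖ₑ ^ 2) volume :=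
  (Lp.aestronglyMeasurable ψ).enorm.pow_const 2

theorem lintegral_enorm_sq (ψ : L2 V) : ∫⁻ x, ‖ψ x‖ₑ ^ 2 = ‖ψ‖ₑ ^ 2 := by
  rw [Lp.enorm_def, eLpNorm_eq_lintegral_rpow_enorm_toReal two_ne_zero ENNReal.ofNat_ne_top,
    ← ENNReal.rpow_natCast, ← ENNReal.rpow_mul]
  simp

theorem density_univ (ψ : L2 V) : density ψ univ = ‖ψ‖ₑ ^ 2 := by
  rw [density, withDensity_apply _ .univ, Measure.restrict_univ, lintegral_enorm_sq]

instance isFiniteMeasure_density (ψ : L2 V) : IsFiniteMeasure (density ψ) :=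
  ⟨by rw [density_univ]; exact ENNReal.pow_lt_top enorm_lt_top⟩

theorem density_absolutelyContinuous (ψ : L2 V) : density ψ ≪ volume :=
  withDensity_absolutelyContinuous _ _

theorem lintegral_density (ψ : L2 V) {g : V → ℝ≥0∞} (hg : AEMeasurable g volume) :
    ∫⁻ x, g x ∂density ψ = ∫⁻ x, g x * ‖ψ x‖ₑ ^ 2 := by
  rw [density, lintegral_withDensity_eq_lintegral_mul₀ (aemeasurable_enorm_sq ψ) hg]
  simp only [Pi.mul_apply, mul_comm]

theorem inner_posFun {g : V → ℂ} (hg : MemLp g ∞ (volume : Measure V)) (ψ : L2 V) :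
    ⟪ψ, posFun g ψ⟫_ℂ = ∫ x, g x ∂density ψ := by
  rw [L2.inner_def, density, integral_withDensity_eq_integral_toReal_smul₀
    (aemeasurable_enorm_sq ψ) (ae_of_all _ fun x => ENNReal.pow_lt_top enorm_lt_top)]
  refine integral_congr_ae ?_
  filter_upwards [coeFn_posFun hg ψ] with x hx
  rw [hx, RCLike.inner_apply', ENNReal.toReal_pow, toReal_enorm, Complex.real_smul, mul_left_comm,
    RCLike.conj_mul, mul_comm]
  push_cast
  rfl

theorem memLp_chi {A : Set V} (hA : MeasurableSet A) :
    MemLp (chi A) ∞ (volume : Measure V) :=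
  memLp_top_of_bound ((measurable_one.indicator hA).aestronglyMeasurable) 1
    (ae_of_all _ fun x => by
      rw [chi]
      by_cases h : x ∈ A <;> simp [h])

theorem inner_posFun_chi {A : Set V} (hA : MeasurableSet A) (ψ : L2 V) :
    ⟪ψ, posFun (chi A) ψ⟫_ℂ = ((density ψ).real A : ℂ) := by
  rw [inner_posFun (memLp_chi hA), chi, integral_indicator hA]
  simp

theorem posFun_one : posFun (chi (univ : Set V)) = ContinuousLinearMap.id ℂ (L2 V) := by
  ext1 ψ
  refine Lp.ext ?_
  filter_upwards [coeFn_posFun (memLp_chi MeasurableSet.univ) ψ] with x hx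
  rw [hx, chi, indicator_univ, Pi.one_apply, one_mul]
  rfl

theorem adjoint_fourierOp_apply (x y : L2 V) : ⟪x, fourierInvOp y⟫_ℂ = ⟪fourierOp x, y⟫_ℂ := by
  have h := (Lp.fourierTransformₗᵢ V ℂ).inner_map_map x ((Lp.fourierTransformₗᵢ V ℂ).symm y)
  rw [LinearIsometryEquiv.apply_symm_apply] at h
  exact h.symm

theorem inner_momFun (g : V → ℂ) (ψ : L2 V) :
    ⟪ψ, momFun g ψ⟫_ℂ =
      ⟪fourierOp ψ, posFun (fun ξ => g ((2 * Real.pi) • ξ)) (fourierOp ψ)⟫_ℂ := by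
  rw [momFun, ContinuousLinearMap.comp_apply, adjoint_fourierOp_apply]
  rfl

theorem momFun_one : momFun (chi (univ : Set V)) = ContinuousLinearMap.id ℂ (L2 V) := by
  have h : (fun ξ : V => chi (univ : Set V) ((2 * Real.pi) • ξ)) = chi univ := by
    funext ξ
    simp [chi]
  rw [momFun, h, posFun_one]
  ext1 ψ
  exact (Lp.fourierTransformₗᵢ V ℂ).symm_apply_apply ψ

theorem map_density_of_comp {Φ Ψ : L2 V} {T : V → V}
    (hT : MeasurePreserving T (volume : Measure V) volume) (h : Ψ =ᵐ[volume] Φ ∘ T) :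
    (density Ψ).map T = density Φ := by
  refine map_withDensity_of_comp hT (aemeasurable_enorm_sq Φ) ?_
  filter_upwards [h] with x hx
  rw [hx]
  rfl

end Densities

theorem map_splitConf_density_tensor (ψ : L2 ℝ) (φ : L2 ProbeConf) :
    (density (tensor ψ φ)).map splitConf = (density ψ).prod (density φ) := by
  rw [density, density, density,
    prod_withDensity₀ (aemeasurable_enorm_sq ψ) (aemeasurable_enorm_sq φ)]
  refine map_withDensity_of_comp measurePreserving_splitConf
    ((aemeasurable_enorm_sq ψ).comp_fst.mul (aemeasurable_enorm_sq φ).comp_snd) ?_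
  filter_upwards [(memLp_tensor ψ φ).coeFn_toLp] with x hx
  rw [tensor, hx, enorm_mul, mul_pow]
  rfl

/-! ### The `L²` Fourier transform under linear maps, translations and products. -/

section Fourier

variable {V : Type} [NormedAddCommGroup V] [InnerProductSpace ℝ V] [FiniteDimensional ℝ V]
  [MeasurableSpace V] [BorelSpace V]

/-- On integrable functions the `L²` Fourier transform is given by the Fourier integral. -/
theorem fourierOp_toLp {f : V → ℂ} (h1 : Integrable f) (h2 : MemLp f 2 volume) :
    fourierOp (h2.toLp f) =ᵐ[volume] 𝓕 f := by
  have hcont : Continuous (𝓕 f) :=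
    VectorFourier.fourierIntegral_continuous Real.continuous_fourierChar
      (by exact continuous_inner) h1
  -- Both sides are tested against smooth compactly supported functions: the `L²` transform is
  -- characterised by duality, and the Fourier integral satisfies the same multiplication formula `∫
  -- ĝ f = ∫ g f̂`.
  refine ae_eq_of_integral_contDiff_smul_eq
    ((Lp.memLp _).locallyIntegrable one_le_two) hcont.locallyIntegrable fun g hg hgs => ?_
  have hg' : ContDiff ℝ ((⊤ : ℕ∞) : WithTop ℕ∞) (fun x => (g x : ℂ)) := Complex.ofRealCLM.contDiff.comp hg
  have hgs' : HasCompactSupport (fun x => (g x : ℂ)) := hgs.comp_left Complex.ofReal_zero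
  set G : SchwartzMap V ℂ := hgs'.toSchwartzMap hg' with hG
  have hGg : ∀ x, G x = g x := fun x => rfl
  have key := congrArg (fun T => T G) (Lp.fourier_toTemperedDistribution_eq (h2.toLp f))
  simp only [TemperedDistribution.fourier_apply, Lp.toTemperedDistribution_apply] at key
  have flip := VectorFourier.integral_fourierIntegral_smul_eq_flip (μ := volume) (ν := volume)
    (L := innerₗ V) (f := G) (g := f) Real.continuous_fourierChar
    (by exact continuous_inner) G.integrable h1
  have e1 : ∫ x, g x • fourierOp (h2.toLp f) x = ∫ x, (𝓕 G) x • (h2.toLp f) x := key.symm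
  have e2 : ∫ x, (𝓕 G) x • (h2.toLp f) x = ∫ x, (𝓕 G) x • f x := by
    refine integral_congr_ae ?_
    filter_upwards [h2.coeFn_toLp] with x hx
    rw [hx]
  rw [flip_innerₗ] at flip
  exact e1.trans (e2.trans flip)

/-- Schwartz functions are integrable and dense in `L²`, so continuous identities need checking only
where the transform is an honest integral. -/
theorem eq_of_eqOn_integrable {W : Type*} [TopologicalSpace W] [T2Space W] {A B : L2 V → W}
    (hA : Continuous A) (hB : Continuous B)
    (h : ∀ (f : V → ℂ) (_ : Integrable f) (h2 : MemLp f 2 volume), A (h2.toLp f) = B (h2.toLp f)) :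
    A = B := by
  have hd := SchwartzMap.denseRange_toLpCLM (E := V) (F := ℂ) (p := 2) (μ := volume)
    ENNReal.ofNat_ne_top
  refine funext fun f => hd.induction_on (p := fun f => A f = B f) f (isClosed_eq hA hB) fun g => ?_
  exact h g g.integrable (g.memLp 2)

/-- Substitute `y = A x` in the Fourier integral. The pairing condition says that `B` plays the role
of the inverse transpose of `A`. -/
theorem fourierOp_comp {A B : V → V} (hA : MeasurePreserving A (volume : Measure V) volume)
    (hAe : MeasurableEmbedding A) (hB : MeasurePreserving B (volume : Measure V) volume)
    (hAB : ∀ x ξ, ⟪x, ξ⟫_ℝ = ⟪A x, B ξ⟫_ℝ) (Φ : L2 V) :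
    fourierOp (Lp.compMeasurePreserving A hA Φ) =
      Lp.compMeasurePreserving B hB (fourierOp Φ) := by
  refine congrFun (eq_of_eqOn_integrable
    (A := fun Φ => fourierOp (Lp.compMeasurePreserving A hA Φ))
    (B := fun Φ => Lp.compMeasurePreserving B hB (fourierOp Φ))
    (fourierOp.continuous.comp (Lp.isometry_compMeasurePreserving hA).continuous)
    ((Lp.isometry_compMeasurePreserving hB).continuous.comp fourierOp.continuous)
    fun f h1 h2 => ?_) Φ
  simp only [Lp.toLp_compMeasurePreserving h2 hA]
  refine Lp.ext ?_
  filter_upwards [fourierOp_toLp (hA.integrable_comp_of_integrable h1)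
    (h2.comp_measurePreserving hA), Lp.coeFn_compMeasurePreserving (fourierOp (h2.toLp f)) hB,
    hB.quasiMeasurePreserving.tendsto_ae.eventually (fourierOp_toLp h1 h2)] with ξ e1 e2 e3
  rw [e1, e2, Function.comp_apply, e3, Real.fourier_eq, Real.fourier_eq]
  simp only [hAB _ ξ, Function.comp_apply]
  exact hA.integral_comp hAe (fun y => Real.fourierChar (-⟪y, B ξ⟫_ℝ) • f y)

theorem fourierOp_translate (v : V) (φ : L2 V) :
    fourierOp (Lp.compMeasurePreserving (· + v) (measurePreserving_add_right volume v) φ) =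
      posFun (fun ξ => (Real.fourierChar ⟪v, ξ⟫_ℝ : ℂ)) (fourierOp φ) := by
  have hm : MemLp (fun ξ : V => (Real.fourierChar ⟪v, ξ⟫_ℝ : ℂ)) ∞ (volume : Measure V) :=
    memLp_top_of_bound (by fun_prop) 1 (ae_of_all _ fun ξ => (Circle.norm_coe _).le)
  have hA := measurePreserving_add_right (volume : Measure V) v
  refine congrFun (eq_of_eqOn_integrable
    (A := fun Φ => fourierOp (Lp.compMeasurePreserving (· + v) hA Φ))
    (B := fun Φ => posFun (fun ξ => (Real.fourierChar ⟪v, ξ⟫_ℝ : ℂ)) (fourierOp Φ))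
    (fourierOp.continuous.comp (Lp.isometry_compMeasurePreserving hA).continuous)
    ((posFun _).continuous.comp fourierOp.continuous)
    fun f h1 h2 => ?_) φ
  simp only [Lp.toLp_compMeasurePreserving h2 hA]
  refine Lp.ext ?_
  filter_upwards [fourierOp_toLp (hA.integrable_comp_of_integrable h1)
    (h2.comp_measurePreserving hA), coeFn_posFun hm (fourierOp (h2.toLp f)),
    fourierOp_toLp h1 h2] with ξ e1 e2 e3
  rw [e1, e2, e3, Real.fourier_eq, Real.fourier_eq, ← smul_eq_mul, ← integral_smul]
  refine (integral_congr_ae (ae_of_all _ fun x => ?_)).trans (integral_add_right_eq_self _ v)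
  simp only [Function.comp_apply, inner_add_left, neg_add, AddChar.map_add_eq_mul, Circle.smul_def,
    Circle.coe_mul, smul_eq_mul]
  have : (Real.fourierChar ⟪v, ξ⟫_ℝ : ℂ) * (Real.fourierChar (-⟪v, ξ⟫_ℝ) : ℂ) = 1 := by
    rw [← Circle.coe_mul, ← AddChar.map_add_eq_mul]
    simp
  linear_combination (-(Real.fourierChar (-⟪x, ξ⟫_ℝ) : ℂ) * f (x + v)) * this

end Fourier

theorem tendsto_fst_splitConf :
    Filter.Tendsto (fun x : TotalConf => (splitConf x).1) (ae volume) (ae volume) :=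
  Measure.quasiMeasurePreserving_fst.tendsto_ae.comp
    measurePreserving_splitConf.quasiMeasurePreserving.tendsto_ae

theorem norm_tensor_le (ψ : L2 ℝ) (φ : L2 ProbeConf) : ‖tensor ψ φ‖ ≤ ‖φ‖ * ‖ψ‖ :=
  (norm_tensor ψ φ).le.trans (mul_comm _ _).le

/-- The bounded operator `ψ ↦ ψ ⊗ φ`. -/
def tensorRight (φ : L2 ProbeConf) : L2 ℝ →L[ℂ] L2 TotalConf :=
  LinearMap.mkContinuous
    { toFun := fun ψ => tensor ψ φ
      map_add' := fun ψ₁ ψ₂ => by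
        rw [tensor, tensor, tensor, ← MemLp.toLp_add]
        apply MemLp.toLp_congr
        filter_upwards [tendsto_fst_splitConf.eventually (Lp.coeFn_add ψ₁ ψ₂)] with x hx
        simp only [hx, Pi.add_apply, add_mul]
      map_smul' := fun c ψ => by
        rw [tensor, tensor, RingHom.id_apply, ← MemLp.toLp_const_smul]
        apply MemLp.toLp_congr
        filter_upwards [tendsto_fst_splitConf.eventually (Lp.coeFn_smul c ψ)] with x hx
        simp only [hx, Pi.smul_apply, smul_eq_mul, mul_assoc] }
    ‖φ‖ (fun ψ => norm_tensor_le ψ φ)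

theorem inner_splitConf (x ξ : TotalConf) :
    ⟪x, ξ⟫_ℝ = ⟪(splitConf x).1, (splitConf ξ).1⟫_ℝ + ⟪(splitConf x).2, (splitConf ξ).2⟫_ℝ := by
  simp [splitConf, PiLp.inner_apply, Fin.sum_univ_succ]

/-- The Fourier kernel factorises along the coordinate splitting, so Fubini gives the claim for
integrable factors; density is applied to one factor at a time with the other fixed. -/
theorem fourierOp_tensor (ψ : L2 ℝ) (φ : L2 ProbeConf) :
    fourierOp (tensor ψ φ) = tensor (fourierOp ψ) (fourierOp φ) := by
  have hs := measurePreserving_splitConf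
  refine congrFun (eq_of_eqOn_integrable (A := fun ψ => fourierOp (tensor ψ φ))
    (B := fun ψ => tensor (fourierOp ψ) (fourierOp φ))
    (fourierOp ∘L tensorRight φ).continuous
    (tensorRight (fourierOp φ) ∘L fourierOp).continuous fun f f1 f2 => ?_) ψ
  refine congrFun (eq_of_eqOn_integrable (A := fun φ => fourierOp (tensor (f2.toLp f) φ))
    (B := fun φ => tensor (fourierOp (f2.toLp f)) (fourierOp φ))
    (fourierOp ∘L tensorLeft (f2.toLp f)).continuous
    (tensorLeft (fourierOp (f2.toLp f)) ∘L fourierOp).continuous fun g g1 g2 => ?_) φ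
  have e0 : (fun x : TotalConf => (f2.toLp f) (splitConf x).1 * (g2.toLp g) (splitConf x).2)
      =ᵐ[volume] fun x => f (splitConf x).1 * g (splitConf x).2 := by
    filter_upwards [tendsto_fst_splitConf.eventually f2.coeFn_toLp,
      tendsto_snd_splitConf.eventually g2.coeFn_toLp] with x h1 h2
    rw [h1, h2]
  have hi : Integrable (fun x : TotalConf => f (splitConf x).1 * g (splitConf x).2) :=
    hs.integrable_comp_of_integrable (f1.mul_prod g1)
  have hl := (memLp_congr_ae e0).1 (memLp_tensor (f2.toLp f) (g2.toLp g))
  have e1 : tensor (f2.toLp f) (g2.toLp g) = hl.toLp _ := MemLp.toLp_congr _ _ e0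
  simp only [e1]
  refine Lp.ext ?_
  filter_upwards [fourierOp_toLp hi hl, (memLp_tensor (fourierOp (f2.toLp f))
    (fourierOp (g2.toLp g))).coeFn_toLp, tendsto_fst_splitConf.eventually (fourierOp_toLp f1 f2),
    tendsto_snd_splitConf.eventually (fourierOp_toLp g1 g2)] with ξ h1 h2 h3 h4
  rw [h1, tensor, h2, h3, h4, Real.fourier_eq, Real.fourier_eq, Real.fourier_eq,
    ← integral_prod_mul, ← Measure.volume_eq_prod, ← hs.map_eq, integral_map hs.measurable.aemeasurable]
  · refine integral_congr_ae (ae_of_all _ fun x => ?_)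
    simp only [inner_splitConf, neg_add, AddChar.map_add_eq_mul, Circle.smul_def,
      Circle.coe_mul, smul_eq_mul]
    ring
  · rw [hs.map_eq]
    exact (((Real.fourierIntegral_convergent_iff _).2 f1).mul_prod
      ((Real.fourierIntegral_convergent_iff _).2 g1)).aestronglyMeasurable

/-! ### The uncertainty relation for a single wave function, via Weyl operators. -/

section Uncertainty

variable {V : Type} [NormedAddCommGroup V] [InnerProductSpace ℝ V] [FiniteDimensional ℝ V]
  [MeasurableSpace V] [BorelSpace V]

/-- Symmetry of the unbounded operator of multiplication by a real function, used only on vectors of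
its domain. -/
theorem inner_toLp_mul_comm {w : V → ℝ} {φ χ : L2 V}
    (hφ : MemLp (fun x => (w x : ℂ) * φ x) 2 volume)
    (hχ : MemLp (fun x => (w x : ℂ) * χ x) 2 volume) :
    ⟪φ, hχ.toLp _⟫_ℂ = ⟪hφ.toLp _, χ⟫_ℂ := by
  rw [L2.inner_def, L2.inner_def]
  refine integral_congr_ae ?_
  filter_upwards [hφ.coeFn_toLp, hχ.coeFn_toLp] with x h1 h2
  rw [h1, h2, RCLike.inner_apply, RCLike.inner_apply, map_mul, Complex.conj_ofReal]
  ring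

/-- The group of Weyl operators `φ ↦ exp (i t b) φ(· + t v)`. -/
def weylShift (v : V) (b t : ℝ) (φ : L2 V) : L2 V :=
  Complex.exp (Complex.I * ((t * b : ℝ) : ℂ)) •
    Lp.compMeasurePreservingₗᵢ ℂ (· + t • v) (measurePreserving_add_right volume (t • v)) φ

theorem inner_weylShift (v : V) (b t : ℝ) (φ χ : L2 V) :
    ⟪weylShift v b t φ, weylShift v b t χ⟫_ℂ = ⟪φ, χ⟫_ℂ := by
  rw [weylShift, weylShift, inner_smul_left, inner_smul_right, LinearIsometry.inner_map_map,
    ← mul_assoc, RCLike.conj_mul, Complex.norm_exp_I_mul_ofReal]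
  simp

theorem norm_weylShift (v : V) (b t : ℝ) (φ : L2 V) : ‖weylShift v b t φ‖ = ‖φ‖ := by
  rw [weylShift, norm_smul, Complex.norm_exp_I_mul_ofReal, one_mul, LinearIsometry.norm_map]

theorem coeFn_weylShift (v : V) (b t : ℝ) (φ : L2 V) :
    weylShift v b t φ =ᵐ[volume]
      fun x => Complex.exp (Complex.I * ((t * b : ℝ) : ℂ)) * φ (x + t • v) := by
  have hA := measurePreserving_add_right (volume : Measure V) (t • v)
  filter_upwards [Lp.coeFn_smul (Complex.exp (Complex.I * ((t * b : ℝ) : ℂ)))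
    (Lp.compMeasurePreserving (· + t • v) hA φ), Lp.coeFn_compMeasurePreserving φ hA] with x h1 h2
  exact h1.trans (by rw [Pi.smul_apply, h2]; rfl)

theorem fourierOp_weylShift (v : V) (b t : ℝ) (φ : L2 V) :
    fourierOp (weylShift v b t φ) =ᵐ[volume] fun ξ =>
      Complex.exp (Complex.I * ((t * (2 * Real.pi * ⟪v, ξ⟫_ℝ + b) : ℝ) : ℂ)) * fourierOp φ ξ := by
  have hm : MemLp (fun ξ : V => (Real.fourierChar ⟪t • v, ξ⟫_ℝ : ℂ)) ∞ (volume : Measure V) :=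
    memLp_top_of_bound (by fun_prop) 1 (ae_of_all _ fun ξ => (Circle.norm_coe _).le)
  have e : fourierOp (weylShift v b t φ) = Complex.exp (Complex.I * ((t * b : ℝ) : ℂ)) •
      posFun (fun ξ => (Real.fourierChar ⟪t • v, ξ⟫_ℝ : ℂ)) (fourierOp φ) := by
    rw [weylShift, map_smul, ← fourierOp_translate]
    rfl
  rw [e]
  filter_upwards [Lp.coeFn_smul (Complex.exp (Complex.I * ((t * b : ℝ) : ℂ)))
    (posFun (fun ξ => (Real.fourierChar ⟪t • v, ξ⟫_ℝ : ℂ)) (fourierOp φ)),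
    coeFn_posFun hm (fourierOp φ)] with ξ h1 h2
  rw [h1, Pi.smul_apply, h2, smul_eq_mul, ← mul_assoc, Real.fourierChar_apply, ← Complex.exp_add]
  congr 2
  rw [real_inner_smul_left]
  push_cast
  ring

/-- In frequency space the Weyl operator multiplies by `exp(its)` with `s = 2π⟨v, ξ⟩ + b`, and
`|exp(its) - 1| ≤ t|s|`. This bound avoids differentiating the group. -/
theorem norm_weylShift_sub_le (v : V) (b : ℝ) {t : ℝ} (ht : 0 ≤ t) (φ : L2 V)
    (h : MemLp (fun ξ => ((2 * Real.pi * ⟪v, ξ⟫_ℝ + b : ℝ) : ℂ) * fourierOp φ ξ) 2 volume) :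
    ‖weylShift v b t φ - φ‖ ≤ t * ‖h.toLp _‖ := by
  rw [← (Lp.fourierTransformₗᵢ V ℂ).norm_map (weylShift v b t φ - φ)]
  refine Lp.norm_le_mul_norm_of_ae_le_mul ?_
  have e : Lp.fourierTransformₗᵢ V ℂ (weylShift v b t φ - φ) =
      fourierOp (weylShift v b t φ) - fourierOp φ := map_sub _ _ _
  rw [e]
  filter_upwards [Lp.coeFn_sub (fourierOp (weylShift v b t φ)) (fourierOp φ),
    fourierOp_weylShift v b t φ, h.coeFn_toLp] with ξ h1 h2 h3
  rw [h1, Pi.sub_apply, h2, h3, ← sub_one_mul, norm_mul, norm_mul, ← mul_assoc]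
  refine mul_le_mul_of_nonneg_right ?_ (norm_nonneg _)
  refine (Real.norm_exp_I_mul_ofReal_sub_one_le).trans ?_
  rw [norm_mul, Real.norm_of_nonneg ht, Complex.norm_real]

/-- The uncertainty relation for wave functions with finite second moments. -/
theorem uncertainty_of_memLp (u v : V) (a b : ℝ) (φ : L2 V)
    (hw : MemLp (fun x => ((⟪u, x⟫_ℝ + a : ℝ) : ℂ) * φ x) 2 volume)
    (h : MemLp (fun ξ => ((2 * Real.pi * ⟪v, ξ⟫_ℝ + b : ℝ) : ℂ) * fourierOp φ ξ) 2 volume) :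
    |⟪u, v⟫_ℝ| * ‖φ‖ ^ 2 ≤ 2 * (‖hw.toLp _‖ * ‖h.toLp _‖) := by
  set W := hw.toLp _ with hW
  set B := ‖h.toLp _‖ with hB
  set c := ⟪u, v⟫_ℝ with hc
  -- An integrated commutator argument. Multiplication by `⟨u, x⟩ + a` and the Weyl operator commute
  -- up to the scalar `t * c`, so `φt` stays in the domain and `Wt` is the multiplier applied to it.
  have step : ∀ t : ℝ, 0 < t → |c| * ‖φ‖ ^ 2 ≤ B * (2 * ‖W‖ + t * (|c| * ‖φ‖)) := fun t ht => by
    set φt := weylShift v b t φ with hφt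
    set Wt := weylShift v b t (W - ((t * c : ℝ) : ℂ) • φ) with hWt
    have hA := measurePreserving_add_right (volume : Measure V) (t • v)
    have e : Wt =ᵐ[volume] fun x => ((⟪u, x⟫_ℝ + a : ℝ) : ℂ) * φt x := by
      filter_upwards [coeFn_weylShift v b t (W - ((t * c : ℝ) : ℂ) • φ), coeFn_weylShift v b t φ,
        hA.quasiMeasurePreserving.tendsto_ae.eventually (Lp.coeFn_sub W (((t * c : ℝ) : ℂ) • φ)),
        hA.quasiMeasurePreserving.tendsto_ae.eventually (Lp.coeFn_smul ((t * c : ℝ) : ℂ) φ),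
        hA.quasiMeasurePreserving.tendsto_ae.eventually hw.coeFn_toLp] with x h1 h2 h3 h4 h5
      rw [h1, h2, h3, Pi.sub_apply, h4, h5, Pi.smul_apply, smul_eq_mul, inner_add_right,
        real_inner_smul_right]
      push_cast
      ring
    have hwt : MemLp (fun x => ((⟪u, x⟫_ℝ + a : ℝ) : ℂ) * φt x) 2 volume :=
      (memLp_congr_ae e).1 (Lp.memLp Wt)
    have eWt : Wt = hwt.toLp _ := by
      refine Lp.ext ?_
      filter_upwards [e, hwt.coeFn_toLp] with x h1 h2
      rw [h1, h2]
    have i1 : ⟪φt, Wt⟫_ℂ = ⟪φ, W⟫_ℂ - ((t * c : ℝ) : ℂ) * ((‖φ‖ ^ 2 : ℝ) : ℂ) := by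
      rw [hφt, hWt, inner_weylShift, inner_sub_right, inner_smul_right, inner_self_eq_norm_sq_to_K]
      push_cast
      rfl
    have i2 : ⟪φ, Wt⟫_ℂ = ⟪W, φt⟫_ℂ := by rw [eWt]; exact inner_toLp_mul_comm hw hwt
    have i3 : ⟪φ, W⟫_ℂ = ⟪W, φ⟫_ℂ := inner_toLp_mul_comm hw hw
    -- The commutator identity before dividing by `t`: the right side involves only `φt - φ`, whose
    -- norm is at most `t * B`.
    have i4 : -(((t * c) * ‖φ‖ ^ 2 : ℝ) : ℂ) = ⟪φt - φ, Wt⟫_ℂ + ⟪W, φt - φ⟫_ℂ := by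
      rw [inner_sub_left, inner_sub_right, i1, i2, ← i3]
      push_cast
      ring
    have n1 : ‖Wt‖ ≤ ‖W‖ + t * (|c| * ‖φ‖) := by
      rw [hWt, norm_weylShift]
      refine (norm_sub_le _ _).trans (le_of_eq ?_)
      rw [norm_smul, Complex.norm_real, Real.norm_eq_abs, abs_mul, abs_of_pos ht, mul_assoc]
    have n2 : ‖φt - φ‖ ≤ t * B := norm_weylShift_sub_le v b ht.le φ h
    have n3 : t * (|c| * ‖φ‖ ^ 2) ≤ t * B * (2 * ‖W‖ + t * (|c| * ‖φ‖)) := by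
      calc t * (|c| * ‖φ‖ ^ 2) = ‖-(((t * c) * ‖φ‖ ^ 2 : ℝ) : ℂ)‖ := by
            rw [norm_neg, Complex.norm_real, Real.norm_eq_abs, abs_mul, abs_mul, abs_of_pos ht,
              abs_of_nonneg (sq_nonneg ‖φ‖), mul_assoc]
        _ ≤ ‖φt - φ‖ * ‖Wt‖ + ‖W‖ * ‖φt - φ‖ := by
            rw [i4]
            exact (norm_add_le _ _).trans
              (add_le_add (norm_inner_le_norm _ _) (norm_inner_le_norm _ _))
        _ = ‖φt - φ‖ * (‖Wt‖ + ‖W‖) := by ring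
        _ ≤ t * B * (2 * ‖W‖ + t * (|c| * ‖φ‖)) := by
            refine mul_le_mul n2 (by linarith) (by positivity) ?_
            exact mul_nonneg ht.le (norm_nonneg _)
    rw [mul_assoc] at n3
    exact le_of_mul_le_mul_left n3 ht
  -- As `t ↓ 0` the error term vanishes, leaving the sharp factor `2`.
  have hlim : Filter.Tendsto (fun t : ℝ => B * (2 * ‖W‖ + t * (|c| * ‖φ‖)))
      (nhdsWithin 0 (Ioi 0)) (nhds (B * (2 * ‖W‖ + 0 * (|c| * ‖φ‖)))) := by
    refine Filter.Tendsto.mono_left ?_ nhdsWithin_le_nhds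
    exact Continuous.tendsto (by fun_prop) 0
  have := ge_of_tendsto hlim (Filter.eventually_of_mem self_mem_nhdsWithin step)
  linarith

theorem lintegral_sq_density {w : V → ℝ} (hw : Continuous w) (φ : L2 V) :
    ∫⁻ x, ENNReal.ofReal (w x ^ 2) ∂density φ =
      eLpNorm (fun x => (w x : ℂ) * φ x) 2 volume ^ 2 := by
  rw [lintegral_density φ (by fun_prop), eLpNorm_eq_lintegral_rpow_enorm_toReal two_ne_zero
    ENNReal.ofNat_ne_top, ← ENNReal.rpow_natCast, ← ENNReal.rpow_mul]
  simp only [ENNReal.toReal_ofNat, one_div, Nat.cast_ofNat, ne_eq, OfNat.ofNat_ne_zero,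
    not_false_eq_true, inv_mul_cancel₀, ENNReal.rpow_one, ENNReal.rpow_ofNat]
  refine lintegral_congr fun x => ?_
  rw [enorm_mul, mul_pow, ← sq_abs, ENNReal.ofReal_pow (abs_nonneg _), ← Real.norm_eq_abs,
    ← Complex.norm_real, ofReal_norm]

theorem memLp_mul_of_lintegral_ne_top {w : V → ℝ} (hw : Continuous w) (φ : L2 V)
    (h : ∫⁻ x, ENNReal.ofReal (w x ^ 2) ∂density φ ≠ ∞) :
    MemLp (fun x => (w x : ℂ) * φ x) 2 volume := by
  refine ⟨(Complex.continuous_ofReal.comp hw).aestronglyMeasurable.mul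
    (Lp.aestronglyMeasurable φ), lt_top_iff_ne_top.2 fun h' => h ?_⟩
  rw [lintegral_sq_density hw, h']
  rfl

theorem volume_hyperplane {u : V} (hu : u ≠ 0) (a : ℝ) :
    volume {x : V | ⟪u, x⟫_ℝ + a = 0} = 0 := by
  rcases Set.eq_empty_or_nonempty {x : V | ⟪u, x⟫_ℝ + a = 0} with h | ⟨x₀, hx₀⟩
  · rw [h, measure_empty]
  · have e : {x : V | ⟪u, x⟫_ℝ + a = 0} = (· - x₀) ⁻¹' ((innerₗ V u).ker : Set V) := by
      ext x
      simp only [mem_ofPred_eq] at hx₀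
      simp only [mem_ofPred_eq, mem_preimage, SetLike.mem_coe, LinearMap.mem_ker, innerₗ_apply_apply,
        inner_sub_right]
      constructor <;> intro h <;> linarith
    rw [e, (measurePreserving_sub_right volume x₀).measure_preimage
      (Submodule.closed_of_finiteDimensional _).measurableSet.nullMeasurableSet]
    refine Measure.addHaar_submodule _ _ fun h => hu ?_
    have : u ∈ (innerₗ V u).ker := by rw [h]; trivial
    simpa using this

/-- `|φ|²` is absolutely continuous, so a nonzero vector cannot be carried by a hyperplane. This
rules out the convention `0 * ∞ = 0` when the other moment is infinite. -/
theorem lintegral_sq_density_ne_zero {u : V} (hu : u ≠ 0) (a : ℝ) {φ : L2 V} (hφ : φ ≠ 0) :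
    ∫⁻ x, ENNReal.ofReal ((⟪u, x⟫_ℝ + a) ^ 2) ∂density φ ≠ 0 := by
  intro h
  rw [lintegral_eq_zero_iff (by fun_prop)] at h
  have h1 : ∀ᵐ x ∂density φ, ⟪u, x⟫_ℝ + a ≠ 0 :=
    (density_absolutelyContinuous φ).ae_le (by simpa [mem_ae_iff, compl_ofPred] using volume_hyperplane hu a)
  have h2 : ∀ᵐ _ ∂density φ, False := by
    filter_upwards [h, h1] with x hx hx1
    have : (⟪u, x⟫_ℝ + a) ^ 2 ≤ 0 := by simpa using hx
    exact hx1 (pow_eq_zero_iff two_ne_zero |>.1 (le_antisymm this (sq_nonneg _)))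
  have h3 : density φ univ = 0 := by simpa [ae_iff] using h2
  rw [density_univ] at h3
  exact hφ (by simpa using h3)

/-- The uncertainty relation for a position and a momentum coordinate. -/
theorem uncertainty {u v : V} (huv : ⟪u, v⟫_ℝ ≠ 0) (a b : ℝ) (φ : L2 V) :
    ENNReal.ofReal |⟪u, v⟫_ℝ| * ‖φ‖ₑ ^ 2 ≤
      2 * ((∫⁻ x, ENNReal.ofReal ((⟪u, x⟫_ℝ + a) ^ 2) ∂density φ) ^ (1 / 2 : ℝ) *
        (∫⁻ ξ, ENNReal.ofReal ((2 * Real.pi * ⟪v, ξ⟫_ℝ + b) ^ 2) ∂density (fourierOp φ))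
          ^ (1 / 2 : ℝ)) := by
  have hu : u ≠ 0 := fun h => huv (by rw [h, inner_zero_left])
  have hv : (2 * Real.pi) • v ≠ 0 :=
    smul_ne_zero (by positivity) fun h => huv (by rw [h, inner_zero_right])
  by_cases hφ : φ = 0
  · simp [hφ]
  have hFφ : fourierOp φ ≠ 0 := fun h => hφ
    ((Lp.fourierTransformₗᵢ V ℂ).injective (h.trans (map_zero _).symm))
  have z1 := lintegral_sq_density_ne_zero hu a hφ
  have z2 := lintegral_sq_density_ne_zero hv b hFφ
  simp only [real_inner_smul_left] at z2
  set I := ∫⁻ x, ENNReal.ofReal ((⟪u, x⟫_ℝ + a) ^ 2) ∂density φ with hI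
  set J := ∫⁻ ξ, ENNReal.ofReal ((2 * Real.pi * ⟪v, ξ⟫_ℝ + b) ^ 2) ∂density (fourierOp φ) with hJ
  have hh : (0 : ℝ) < 1 / 2 := by norm_num
  by_cases hI' : I = ∞
  · rw [hI', ENNReal.top_rpow_of_pos hh, ENNReal.top_mul (by simpa using z2)]
    simp
  by_cases hJ' : J = ∞
  · rw [hJ', ENNReal.top_rpow_of_pos hh, ENNReal.mul_top (by simpa using z1)]
    simp
  have m1 := memLp_mul_of_lintegral_ne_top (w := fun x => ⟪u, x⟫_ℝ + a) (by fun_prop) φ hI'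
  have m2 := memLp_mul_of_lintegral_ne_top (w := fun ξ => 2 * Real.pi * ⟪v, ξ⟫_ℝ + b) (by fun_prop)
    (fourierOp φ) hJ'
  have key := uncertainty_of_memLp u v a b φ m1 m2
  have s1 : I ^ (1 / 2 : ℝ) = ‖m1.toLp _‖ₑ := by
    rw [hI, lintegral_sq_density (w := fun x => ⟪u, x⟫_ℝ + a) (by fun_prop), ← ENNReal.rpow_natCast,
      ← ENNReal.rpow_mul, Lp.enorm_toLp]
    norm_num
  have s2 : J ^ (1 / 2 : ℝ) = ‖m2.toLp _‖ₑ := by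
    rw [hJ, lintegral_sq_density (w := fun ξ => 2 * Real.pi * ⟪v, ξ⟫_ℝ + b) (by fun_prop),
      ← ENNReal.rpow_natCast, ← ENNReal.rpow_mul, Lp.enorm_toLp]
    norm_num
  rw [s1, s2, ← ofReal_norm, ← ofReal_norm, ← ofReal_norm, ← ENNReal.ofReal_mul (norm_nonneg _),
    ← ENNReal.ofReal_pow (norm_nonneg _), ← ENNReal.ofReal_mul (abs_nonneg _)]
  refine (ENNReal.ofReal_le_ofReal key).trans (le_of_eq ?_)
  rw [ENNReal.ofReal_mul zero_le_two, ENNReal.ofReal_ofNat]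

end Uncertainty

/-! ### Existence of the effective observable -/

/-- Over `ℂ` polarisation recovers an operator from its quadratic form; scaling reduces to unit
vectors, the only ones on which `IsEffectiveObservable` prescribes `G`. -/
theorem eq_of_inner_eq_of_norm_one {H : Type*} [NormedAddCommGroup H] [InnerProductSpace ℂ H]
    {A B : H →L[ℂ] H} (h : ∀ ψ, ‖ψ‖ = 1 → ⟪ψ, A ψ⟫_ℂ = ⟪ψ, B ψ⟫_ℂ) : A = B := by
  have h1 : ∀ ψ, ⟪ψ, A ψ⟫_ℂ = ⟪ψ, B ψ⟫_ℂ := fun ψ => by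
    by_cases hψ : ψ = 0
    · simp [hψ]
    · have hn : (‖ψ‖ : ℂ) ≠ 0 := by exact_mod_cast norm_ne_zero_iff.2 hψ
      have h2 := h ((‖ψ‖ : ℂ)⁻¹ • ψ) (by
        rw [norm_smul, norm_inv, Complex.norm_real, norm_norm]
        exact inv_mul_cancel₀ (norm_ne_zero_iff.2 hψ))
      simp only [map_smul, inner_smul_left, inner_smul_right] at h2
      exact mul_left_cancel₀ ((map_ne_zero (starRingEnd ℂ)).2 (inv_ne_zero hn))
        (mul_left_cancel₀ (inv_ne_zero hn) h2)
  refine ContinuousLinearMap.coe_injective ((ext_inner_map _ _).1 fun ψ => ?_)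
  rw [← inner_conj_symm, ← inner_conj_symm (B.toLinearMap ψ)]
  exact congrArg _ (h1 ψ)

theorem norm_tensorRight_le (φ : L2 ProbeConf) : ‖tensorRight φ‖ ≤ ‖φ‖ :=
  LinearMap.mkContinuous_norm_le _ (norm_nonneg _) _

/-- The final state of system and probes, if the initial state is `ψ ⊗ φ`. -/
def finalState (lam mu kap : ℝ) (ψ : L2 ℝ) (φ : L2 ProbeConf) : L2 TotalConf :=
  coupling lam mu kap (tensor ψ φ)

theorem hasSum_trace_finalState (lam mu kap : ℝ) {ι : Type*} {σ : L2 ProbeConf →L[ℂ] L2 ProbeConf}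
    {φ : ι → L2 ProbeConf} (hφ : Summable fun i => ‖φ i‖ ^ 2)
    (hσ : ∀ x, HasSum (fun i => ⟪φ i, x⟫_ℂ • φ i) (σ x)) (ψ : L2 ℝ)
    (B : L2 TotalConf →L[ℂ] L2 TotalConf) :
    HasSum (fun i => ⟪finalState lam mu kap ψ (φ i), B (finalState lam mu kap ψ (φ i))⟫_ℂ)
      (trace ((coupling lam mu kap ∘L productState ψ σ ∘L (coupling lam mu kap).adjoint) ∘L B)) := by
  have h := hasSum_trace_conj_comp hφ hσ (coupling lam mu kap ∘L tensorLeft ψ) B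
  have e : (coupling lam mu kap ∘L tensorLeft ψ) ∘L σ ∘L
      (coupling lam mu kap ∘L tensorLeft ψ).adjoint =
      coupling lam mu kap ∘L productState ψ σ ∘L (coupling lam mu kap).adjoint := by
    rw [ContinuousLinearMap.adjoint_comp]
    rfl
  rw [e] at h
  exact h

/-- With `Vᵢ ψ = ψ ⊗ φᵢ` the effect is `∑ᵢ Vᵢ* U* B U Vᵢ`, norm convergent because `‖Vᵢ‖ ≤ ‖φᵢ‖`. -/
theorem exists_isEffectiveObservable (lam mu kap : ℝ) (σ : DensityOperator (L2 ProbeConf)) :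
    ∃ G, IsEffectiveObservable lam mu kap σ G := by
  obtain ⟨ι, _, φ, hφ, hσ⟩ := σ.exists_countable_hasSum
  have key : ∀ B : L2 TotalConf →L[ℂ] L2 TotalConf, ∃ T : L2 ℝ →L[ℂ] L2 ℝ, ∀ ψ,
      ⟪ψ, T ψ⟫_ℂ = trace ((coupling lam mu kap ∘L productState ψ σ.op ∘L
        (coupling lam mu kap).adjoint) ∘L B) := fun B => by
    set C : L2 TotalConf →L[ℂ] L2 TotalConf :=
      (coupling lam mu kap).adjoint ∘L B ∘L coupling lam mu kap with hC
    have hs : Summable fun i => (tensorRight (φ i)).adjoint ∘L C ∘L tensorRight (φ i) := by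
      refine Summable.of_norm_bounded (hφ.summable.mul_left ‖C‖) fun i => ?_
      refine (ContinuousLinearMap.opNorm_comp_le _ _).trans ?_
      rw [LinearIsometryEquiv.norm_map]
      have h1 := norm_tensorRight_le (φ i)
      calc ‖tensorRight (φ i)‖ * ‖C ∘L tensorRight (φ i)‖
          ≤ ‖φ i‖ * (‖C‖ * ‖φ i‖) := mul_le_mul h1 ((ContinuousLinearMap.opNorm_comp_le _ _).trans
            (mul_le_mul_of_nonneg_left h1 (norm_nonneg _))) (norm_nonneg _) (norm_nonneg _)
        _ = ‖C‖ * ‖φ i‖ ^ 2 := by ring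
    refine ⟨∑' i, (tensorRight (φ i)).adjoint ∘L C ∘L tensorRight (φ i), fun ψ => ?_⟩
    have h1 := (hs.hasSum.mapL (ContinuousLinearMap.apply ℂ (L2 ℝ) ψ)).mapL (innerSL ℂ ψ)
    refine h1.unique ?_
    have h2 := hasSum_trace_finalState lam mu kap hφ.summable hσ ψ B
    convert! h2 using 2 with i
    simp only [ContinuousLinearMap.apply_apply, ContinuousLinearMap.comp_apply, hC,
      innerSL_apply_apply, ContinuousLinearMap.adjoint_inner_right]
    rfl
  choose T hT using key
  exact ⟨fun X Y => T _, fun X Y _ _ ψ _ => hT _ ψ⟩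

/-! ### The distribution of the pointer readings -/

/-- The coupling flow in the momentum representation: the inverse transpose of the matrix of
`couplingFlow lam mu kap 1`. -/
def dualFlow (lam mu kap : ℝ) (ξ : TotalConf) : TotalConf :=
  !₂[ξ 0 + lam * ξ 1, ξ 1, ξ 2 - mu * ξ 0 + (lam * mu / 2 * (kap - 1)) * ξ 1]

theorem dualFlow_eq_toLpLin (lam mu kap : ℝ) :
    dualFlow lam mu kap = Matrix.toLpLin 2 2
      !![1, lam, 0; 0, 1, 0; -mu, lam * mu / 2 * (kap - 1), 1] := by
  funext x
  ext i
  fin_cases i <;>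
    simp [dualFlow, Matrix.toLpLin_apply, dotProduct, Fin.sum_univ_three]
  ring

theorem measurePreserving_dualFlow (lam mu kap : ℝ) :
    MeasurePreserving (dualFlow lam mu kap) (volume : Measure TotalConf) volume := by
  have hdet : LinearMap.det (Matrix.toLpLin 2 2
      !![1, lam, 0; 0, 1, 0; -mu, lam * mu / 2 * (kap - 1), 1]) = 1 := by
    rw [LinearMap.det_toLpLin, Matrix.det_fin_three]
    simp
  rw [dualFlow_eq_toLpLin]
  refine ⟨(LinearMap.continuous_of_finiteDimensional _).measurable, ?_⟩
  rw [Measure.map_linearMap_addHaar_eq_smul_addHaar _ (by rw [hdet]; exact one_ne_zero), hdet]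
  simp

theorem inner_couplingFlow_dualFlow (lam mu kap : ℝ) (x ξ : TotalConf) :
    ⟪x, ξ⟫_ℝ = ⟪couplingFlow lam mu kap 1 x, dualFlow lam mu kap ξ⟫_ℝ := by
  simp only [PiLp.inner_apply, Fin.sum_univ_three, couplingFlow, dualFlow, RCLike.inner_apply,
    conj_trivial, Matrix.cons_val]
  ring

theorem measurableEmbedding_couplingFlow (lam mu kap t : ℝ) :
    MeasurableEmbedding (couplingFlow lam mu kap t) := by
  have hc : ∀ s, Measurable (couplingFlow lam mu kap s) := fun s =>
    (measurePreserving_couplingFlow lam mu kap s).measurable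
  have hi : ∀ s x, couplingFlow lam mu kap (-s) (couplingFlow lam mu kap s x) = x := fun s x => by
    rw [← couplingFlow_add, neg_add_cancel, couplingFlow_zero]
  exact (MeasurableEquiv.mk ⟨couplingFlow lam mu kap t, couplingFlow lam mu kap (-t), hi t,
    fun x => by simpa using hi (-t) x⟩ (hc t) (hc (-t))).measurableEmbedding

/-- In the flowed coordinates the final position density is again a product: system and probe become
independent. -/
theorem map_density_finalState (lam mu kap : ℝ) (ψ : L2 ℝ) (φ : L2 ProbeConf) :
    (density (finalState lam mu kap ψ φ)).map (splitConf ∘ couplingFlow lam mu kap 1) =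
      (density ψ).prod (density φ) := by
  have hA := measurePreserving_couplingFlow lam mu kap 1
  rw [← Measure.map_map measurePreserving_splitConf.measurable hA.measurable,
    map_density_of_comp hA (Φ := tensor ψ φ), map_splitConf_density_tensor]
  exact Lp.coeFn_compMeasurePreserving _ hA

theorem map_density_fourierOp_finalState (lam mu kap : ℝ) (ψ : L2 ℝ) (φ : L2 ProbeConf) :
    (density (fourierOp (finalState lam mu kap ψ φ))).map (splitConf ∘ dualFlow lam mu kap) =
      (density (fourierOp ψ)).prod (density (fourierOp φ)) := by
  have hB := measurePreserving_dualFlow lam mu kap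
  have e : fourierOp (finalState lam mu kap ψ φ) =
      Lp.compMeasurePreserving _ hB (tensor (fourierOp ψ) (fourierOp φ)) := by
    rw [← fourierOp_tensor]
    exact fourierOp_comp (measurePreserving_couplingFlow lam mu kap 1)
      (measurableEmbedding_couplingFlow lam mu kap 1) hB (inner_couplingFlow_dualFlow lam mu kap) _
  rw [← Measure.map_map measurePreserving_splitConf.measurable hB.measurable, e,
    map_density_of_comp hB (Φ := tensor (fourierOp ψ) (fourierOp φ)), map_splitConf_density_tensor]
  exact Lp.coeFn_compMeasurePreserving _ hB

/-- The position noise is the distribution of `-(Q₁/λ + μ(κ-1)Q₂/2)` in the probe state. -/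
def noisePosVec (lam mu kap : ℝ) : ProbeConf := !₂[1 / lam, mu / 2 * (kap - 1)]

/-- The momentum noise is the distribution of `-(P₂/μ - λ(κ+1)P₁/2)` in the probe state. -/
def noiseMomVec (lam mu kap : ℝ) : ProbeConf := !₂[-(lam / 2 * (kap + 1)), 1 / mu]

/-- The two contributions are `-(κ+1)/2` and `(κ-1)/2`, so `κ`, `λ` and `μ` all cancel. -/
theorem inner_noisePosVec_noiseMomVec {lam mu : ℝ} (kap : ℝ) (hlam : 0 < lam) (hmu : 0 < mu) :
    ⟪noisePosVec lam mu kap, noiseMomVec lam mu kap⟫_ℝ = -1 := by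
  simp only [PiLp.inner_apply, Fin.sum_univ_two, noisePosVec, noiseMomVec, RCLike.inner_apply,
    conj_trivial, Matrix.cons_val]
  field_simp
  ring

theorem density_finalState_pointer {lam : ℝ} (mu kap : ℝ) (hlam : 0 < lam) (ψ : L2 ℝ)
    (φ : L2 ProbeConf) {X : Set ℝ} (hX : MeasurableSet X) :
    density (finalState lam mu kap ψ φ) {x | x 1 ∈ (fun x => lam * x) '' X} =
      ((density ψ).prod (density φ)) {z | 1 * z.1 + ⟪noisePosVec lam mu kap, z.2⟫_ℝ ∈ X} := by
  have hm : MeasurableSet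
      {z : ℝ × ProbeConf | 1 * z.1 + ⟪noisePosVec lam mu kap, z.2⟫_ℝ ∈ X} :=
    measurableSet_preimage (by fun_prop) hX
  rw [← map_density_finalState lam mu kap, Measure.map_apply
    (measurePreserving_splitConf.measurable.comp
      (measurePreserving_couplingFlow lam mu kap 1).measurable) hm]
  congr 1
  ext x
  -- The reading `q₁/λ` in flowed coordinates is the system position plus the noise. The factor `1`
  -- is kept to match the `2π` of the momentum case.
  have e : 1 * (splitConf (couplingFlow lam mu kap 1 x)).1 +
      ⟪noisePosVec lam mu kap, (splitConf (couplingFlow lam mu kap 1 x)).2⟫_ℝ = x 1 / lam := by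
    simp only [PiLp.inner_apply, Fin.sum_univ_two, noisePosVec, splitConf, couplingFlow,
      RCLike.inner_apply, conj_trivial, PiLp.toLp_apply, Matrix.cons_val]
    field_simp
    ring
  simp only [mem_ofPred_eq, mem_preimage, Function.comp_apply, e, mem_image]
  constructor
  · rintro ⟨y, hy, h⟩
    rwa [← h, mul_div_cancel_left₀ _ hlam.ne']
  · exact fun h => ⟨_, h, mul_div_cancel₀ _ hlam.ne'⟩

theorem density_fourierOp_finalState_pointer (lam : ℝ) {mu : ℝ} (kap : ℝ) (hmu : 0 < mu)
    (ψ : L2 ℝ) (φ : L2 ProbeConf) {Y : Set ℝ} (hY : MeasurableSet Y) :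
    density (fourierOp (finalState lam mu kap ψ φ))
        {ξ | ((2 * Real.pi) • ξ) 2 ∈ (fun y => mu * y) '' Y} =
      ((density (fourierOp ψ)).prod (density (fourierOp φ)))
        {z | 2 * Real.pi * z.1 + 2 * Real.pi * ⟪noiseMomVec lam mu kap, z.2⟫_ℝ ∈ Y} := by
  have hm : MeasurableSet {z : ℝ × ProbeConf |
      2 * Real.pi * z.1 + 2 * Real.pi * ⟪noiseMomVec lam mu kap, z.2⟫_ℝ ∈ Y} :=
    measurableSet_preimage (by fun_prop) hY
  rw [← map_density_fourierOp_finalState lam mu kap, Measure.map_apply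
    (measurePreserving_splitConf.measurable.comp
      (measurePreserving_dualFlow lam mu kap).measurable) hm]
  congr 1
  ext x
  have e : 2 * Real.pi * (splitConf (dualFlow lam mu kap x)).1 +
      2 * Real.pi * ⟪noiseMomVec lam mu kap, (splitConf (dualFlow lam mu kap x)).2⟫_ℝ =
        ((2 * Real.pi) • x) 2 / mu := by
    simp only [PiLp.inner_apply, Fin.sum_univ_two, noiseMomVec, splitConf, dualFlow,
      RCLike.inner_apply, conj_trivial, PiLp.toLp_apply, Matrix.cons_val, PiLp.smul_apply,
      smul_eq_mul]
    field_simp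
    ring
  simp only [mem_ofPred_eq, mem_preimage, Function.comp_apply, e, mem_image]
  constructor
  · rintro ⟨y, hy, h⟩
    rwa [← h, mul_div_cancel_left₀ _ hmu.ne']
  · exact fun h => ⟨_, h, mul_div_cancel₀ _ hmu.ne'⟩

/-! ### The noise distributions -/

/-- The distribution of `-r` in the state `∑ᵢ |χᵢ⟩⟨χᵢ|` of the probes. -/
def noise {ι : Type*} (χ : ι → L2 ProbeConf) (r : ProbeConf → ℝ) : Measure ℝ :=
  Measure.sum fun i => (density (χ i)).map fun w => -r w

theorem tsum_enorm_sq {ι H : Type*} [NormedAddCommGroup H] {χ : ι → H}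
    (hχ : HasSum (fun i => ‖χ i‖ ^ 2) 1) : ∑' i, ‖χ i‖ₑ ^ 2 = 1 := by
  have h := ENNReal.ofReal_tsum_of_nonneg (fun i => sq_nonneg ‖χ i‖) hχ.summable
  rw [hχ.tsum_eq, ENNReal.ofReal_one] at h
  rw [h]
  exact tsum_congr fun i => by rw [ENNReal.ofReal_pow (norm_nonneg _), ofReal_norm]

theorem isProbabilityMeasure_noise {ι : Type*} {χ : ι → L2 ProbeConf} {r : ProbeConf → ℝ}
    (hχ : HasSum (fun i => ‖χ i‖ ^ 2) 1) (hr : Measurable r) :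
    IsProbabilityMeasure (noise χ r) := by
  refine ⟨?_⟩
  rw [noise, Measure.sum_apply _ .univ, ← tsum_enorm_sq hχ]
  refine tsum_congr fun i => ?_
  rw [Measure.map_apply (by fun_prop) .univ, preimage_univ, density_univ]

theorem lintegral_noise {ι : Type*} (χ : ι → L2 ProbeConf) {r : ProbeConf → ℝ}
    (hr : Measurable r) {g : ℝ → ℝ≥0∞} (hg : Measurable g) :
    ∫⁻ y, g y ∂noise χ r = ∑' i, ∫⁻ w, g (-r w) ∂density (χ i) := by
  rw [noise, lintegral_sum_measure]
  exact tsum_congr fun i => lintegral_map hg hr.neg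

theorem measurable_measure_translate (m : Measure ℝ) [SFinite m] (c : ℝ) {X : Set ℝ}
    (hX : MeasurableSet X) : Measurable fun q : ℝ => m {y | c * q - y ∈ X} := by
  have h : MeasurableSet {p : ℝ × ℝ | c * p.1 - p.2 ∈ X} :=
    measurableSet_preimage (by fun_prop) hX
  exact measurable_measure_prodMk_left h

/-- Tonelli, integrating out the probe for fixed `q`. The sign in `noise` turns `c * q + r` into the
difference that `smear` expects. -/
theorem tsum_density_prod {ι : Type*} [Countable ι] {χ : ι → L2 ProbeConf} {r : ProbeConf → ℝ}
    (hr : Measurable r) (c : ℝ) (ψ : L2 ℝ) {X : Set ℝ} (hX : MeasurableSet X) :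
    ∑' i, ((density ψ).prod (density (χ i))) {z | c * z.1 + r z.2 ∈ X} =
      ∫⁻ q, noise χ r {y | c * q - y ∈ X} ∂density ψ := by
  have h1 : MeasurableSet {z : ℝ × ProbeConf | c * z.1 + r z.2 ∈ X} :=
    measurableSet_preimage (by fun_prop) hX
  have h2 : ∀ q, MeasurableSet {y : ℝ | c * q - y ∈ X} := fun q =>
    measurableSet_preimage (by fun_prop) hX
  simp only [Measure.prod_apply h1]
  rw [← lintegral_tsum fun i => (measurable_measure_prodMk_left h1).aemeasurable]
  refine lintegral_congr fun q => ?_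
  rw [noise, Measure.sum_apply _ (h2 q)]
  refine tsum_congr fun i => ?_
  rw [Measure.map_apply (by fun_prop) (h2 q)]
  congr 1
  ext w
  simp

theorem memLp_smear (m : Measure ℝ) [IsProbabilityMeasure m] (c : ℝ) {X : Set ℝ}
    (hX : MeasurableSet X) : MemLp (fun q => smear m X (c * q)) ∞ (volume : Measure ℝ) := by
  refine memLp_top_of_bound (Complex.measurable_ofReal.comp
    (measurable_measure_translate m c hX).ennreal_toReal).aestronglyMeasurable 1
    (ae_of_all _ fun q => ?_)
  rw [smear, Complex.norm_real, Real.norm_of_nonneg measureReal_nonneg]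
  exact measureReal_le_one

theorem integral_smear (m : Measure ℝ) [IsProbabilityMeasure m] (c : ℝ) {X : Set ℝ}
    (hX : MeasurableSet X) (ν : Measure ℝ) :
    ∫ q, smear m X (c * q) ∂ν = ((∫⁻ q, m {y | c * q - y ∈ X} ∂ν).toReal : ℂ) := by
  rw [← integral_toReal (measurable_measure_translate m c hX).aemeasurable
    (ae_of_all _ fun q => measure_lt_top _ _)]
  exact integral_ofReal

theorem inner_posFun_smear (m : Measure ℝ) [IsProbabilityMeasure m] (c : ℝ) {X : Set ℝ}
    (hX : MeasurableSet X) (ψ : L2 ℝ) :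
    ⟪ψ, posFun (fun q => smear m X (c * q)) ψ⟫_ℂ =
      ((∫⁻ q, m {y | c * q - y ∈ X} ∂density ψ).toReal : ℂ) := by
  rw [inner_posFun (memLp_smear m c hX), integral_smear m c hX]

theorem hasSum_density_prod {ι : Type*} [Countable ι] {χ : ι → L2 ProbeConf} {r : ProbeConf → ℝ}
    (hχ : HasSum (fun i => ‖χ i‖ ^ 2) 1) (hr : Measurable r) (c : ℝ) (ψ : L2 ℝ) {X : Set ℝ}
    (hX : MeasurableSet X) :
    HasSum (fun i => ((((density ψ).prod (density (χ i))).real {z | c * z.1 + r z.2 ∈ X} : ℝ) : ℂ))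
      ⟪ψ, posFun (fun q => smear (noise χ r) X (c * q)) ψ⟫_ℂ := by
  have := isProbabilityMeasure_noise hχ hr
  rw [inner_posFun_smear _ c hX, ← tsum_density_prod hr c ψ hX, Complex.hasSum_ofReal]
  have hfin : ∑' i, ((density ψ).prod (density (χ i))) {z | c * z.1 + r z.2 ∈ X} ≠ ∞ := by
    rw [tsum_density_prod hr c ψ hX]
    refine ((lintegral_mono fun q => prob_le_one).trans_lt ?_).ne
    rw [lintegral_one]
    exact measure_lt_top _ _
  rw [ENNReal.tsum_toReal_eq fun i => ENNReal.ne_top_of_tsum_ne_top hfin i]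
  exact ENNReal.hasSum_toReal hfin

/-- For `Y = ℝ` the momentum effect is the identity, leaving only the final position density, whose
pointer law is `q` plus probe noise. -/
theorem isPositionNoise_noise {lam mu : ℝ} (kap : ℝ) (hlam : 0 < lam) (hmu : 0 < mu)
    {σ : DensityOperator (L2 ProbeConf)} {ι : Type*} [Countable ι] {φ : ι → L2 ProbeConf}
    (hφ : HasSum (fun i => ‖φ i‖ ^ 2) 1)
    (hσ : ∀ x, HasSum (fun i => ⟪φ i, x⟫_ℂ • φ i) (σ.op x))
    {G : Set ℝ → Set ℝ → (L2 ℝ →L[ℂ] L2 ℝ)} (hG : IsEffectiveObservable lam mu kap σ G) :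
    IsPositionNoise (fun X => G X univ) (noise φ fun w => ⟪noisePosVec lam mu kap, w⟫_ℝ) := by
  have hr : Measurable fun w : ProbeConf => ⟪noisePosVec lam mu kap, w⟫_ℝ := by fun_prop
  refine ⟨isProbabilityMeasure_noise hφ hr, fun X hX => eq_of_inner_eq_of_norm_one fun ψ hψ => ?_⟩
  have hX' : MeasurableSet ((fun x => lam * x) '' X) :=
    (MeasurableEquiv.mulLeft₀ lam hlam.ne').measurableEmbedding.measurableSet_image.2 hX
  have hu : (fun y => mu * y) '' univ = univ := by
    rw [image_univ, (mul_left_surjective₀ hmu.ne').range_eq]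
  have hP : probeMomentum univ = ContinuousLinearMap.id ℂ (L2 TotalConf) := momFun_one
  rw [hG X univ hX .univ ψ hψ, hu, hP, ContinuousLinearMap.comp_id]
  have h1 := hasSum_trace_finalState lam mu kap hφ.summable hσ ψ
    (probePosition ((fun x => lam * x) '' X))
  have h2 := hasSum_density_prod hφ hr 1 ψ hX
  simp only [one_mul] at h2
  refine h1.unique ?_
  convert! h2 using 2 with i
  have hm : MeasurableSet {x : TotalConf | x 1 ∈ (fun x => lam * x) '' X} :=
    measurableSet_preimage (by fun_prop) hX'
  have hd := density_finalState_pointer mu kap hlam ψ (φ i) hX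
  simp only [one_mul] at hd
  rw [probePosition, inner_posFun_chi hm, Measure.real, hd]
  rfl

theorem isMomentumNoise_noise {lam mu : ℝ} (kap : ℝ) (hlam : 0 < lam) (hmu : 0 < mu)
    {σ : DensityOperator (L2 ProbeConf)} {ι : Type*} [Countable ι] {φ : ι → L2 ProbeConf}
    (hφ : HasSum (fun i => ‖φ i‖ ^ 2) 1)
    (hσ : ∀ x, HasSum (fun i => ⟪φ i, x⟫_ℂ • φ i) (σ.op x))
    {G : Set ℝ → Set ℝ → (L2 ℝ →L[ℂ] L2 ℝ)} (hG : IsEffectiveObservable lam mu kap σ G) :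
    IsMomentumNoise (fun Y => G univ Y) (noise (fun i => fourierOp (φ i))
      fun w => 2 * Real.pi * ⟪noiseMomVec lam mu kap, w⟫_ℝ) := by
  have hr : Measurable fun w : ProbeConf => 2 * Real.pi * ⟪noiseMomVec lam mu kap, w⟫_ℝ := by
    fun_prop
  have hFφ : HasSum (fun i => ‖fourierOp (φ i)‖ ^ 2) 1 := by
    convert! hφ using 3 with i
    exact (Lp.fourierTransformₗᵢ ProbeConf ℂ).norm_map _
  refine ⟨isProbabilityMeasure_noise hFφ hr, fun Y hY => eq_of_inner_eq_of_norm_one fun ψ hψ => ?_⟩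
  have hY' : MeasurableSet ((fun y => mu * y) '' Y) :=
    (MeasurableEquiv.mulLeft₀ mu hmu.ne').measurableEmbedding.measurableSet_image.2 hY
  have hu : (fun x => lam * x) '' univ = univ := by
    rw [image_univ, (mul_left_surjective₀ hlam.ne').range_eq]
  have hP : probePosition univ = ContinuousLinearMap.id ℂ (L2 TotalConf) := posFun_one
  rw [hG univ Y .univ hY ψ hψ, hu, hP, ContinuousLinearMap.id_comp]
  have h1 := hasSum_trace_finalState lam mu kap hφ.summable hσ ψ
    (probeMomentum ((fun y => mu * y) '' Y))
  have h2 := hasSum_density_prod hFφ hr (2 * Real.pi) (fourierOp ψ) hY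
  refine h1.unique ?_
  rw [inner_momFun]
  convert! h2 using 2 with i
  have hm : MeasurableSet {ξ : TotalConf | ((2 * Real.pi) • ξ) 2 ∈ (fun y => mu * y) '' Y} :=
    measurableSet_preimage (by fun_prop) hY'
  rw [probeMomentum, inner_momFun, Measure.real,
    ← density_fourierOp_finalState_pointer lam kap hmu ψ (φ i) hY]
  exact inner_posFun_chi hm _

/-! ### Uniqueness of the noise distributions -/

/-- There is a wave function without zeros, for example a Gaussian. -/
theorem exists_ae_ne_zero : ∃ ψ : L2 ℝ, ∀ᵐ x, ψ x ≠ 0 := by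
  have hm : MemLp (fun x : ℝ => Complex.exp (-(1 : ℝ) * (x : ℂ) ^ 2)) 2 volume := by
    rw [memLp_two_iff_integrable_sq_norm (by fun_prop)]
    have h := integrable_exp_neg_mul_sq (b := 2) two_pos
    refine h.congr (ae_of_all _ fun x => ?_)
    simp only
    rw [Complex.norm_exp, ← Real.exp_nat_mul]
    congr 1
    rw [← Complex.ofReal_neg, ← Complex.ofReal_pow, ← Complex.ofReal_mul, Complex.ofReal_re]
    push_cast
    ring
  exact ⟨hm.toLp _, hm.coeFn_toLp.mono fun x hx => by rw [hx]; exact Complex.exp_ne_zero _⟩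

theorem ae_eq_of_posFun_eq {g h : ℝ → ℂ} (hg : MemLp g ∞ (volume : Measure ℝ))
    (hh : MemLp h ∞ (volume : Measure ℝ)) (e : posFun g = posFun h) : g =ᵐ[volume] h := by
  obtain ⟨ψ, hψ⟩ := exists_ae_ne_zero
  filter_upwards [coeFn_posFun hg ψ, coeFn_posFun hh ψ, hψ] with x h1 h2 h3
  rw [e, h2] at h1
  exact (mul_right_cancel₀ h3 h1).symm

/-- The tail `t ↦ m [t, ∞)` is left continuous, so its values on a dense set determine it. -/
theorem measure_eq_of_dense_Ici {μ ν : Measure ℝ} [IsFiniteMeasure μ] [IsFiniteMeasure ν]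
    {D : Set ℝ} (hD : Dense D) (h : ∀ t ∈ D, μ (Ici t) = ν (Ici t)) : μ = ν := by
  refine Measure.ext_of_Ici _ _ fun t => ?_
  obtain ⟨u, hu, hut, hlim⟩ := hD.exists_seq_strictMono_tendsto t
  have hI : ⋂ n, Ici (u n) = Ici t := by
    ext x
    simp only [mem_iInter, mem_Ici]
    exact ⟨fun hx => le_of_tendsto' hlim hx, fun hx n => (hut n).1.le.trans hx⟩
  have key : ∀ m : Measure ℝ, IsFiniteMeasure m →
      Filter.Tendsto (fun n => m (Ici (u n))) Filter.atTop (nhds (m (Ici t))) := fun m _ => by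
    rw [← hI]
    exact tendsto_measure_iInter_atTop (fun n => measurableSet_Ici.nullMeasurableSet)
      (fun i j hij => Ici_subset_Ici.2 (hu.monotone hij)) ⟨0, measure_ne_top _ _⟩
  refine tendsto_nhds_unique (key μ inferInstance) ?_
  simp only [h _ (hut _).2]
  exact key ν inferInstance

/-- The half line `X = (-∞, 0]` already suffices: smearing it gives the tail function of the noise,
known almost everywhere and hence on a dense set. -/
theorem eq_of_posFun_smear_eq {m m' : Measure ℝ} [IsProbabilityMeasure m]
    [IsProbabilityMeasure m'] {c : ℝ} (hc : c ≠ 0)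
    (h : ∀ X, MeasurableSet X →
      posFun (fun q => smear m X (c * q)) = posFun (fun q => smear m' X (c * q))) : m = m' := by
  have h1 := ae_eq_of_posFun_eq (memLp_smear m c measurableSet_Iic)
    (memLp_smear m' c measurableSet_Iic) (h (Iic 0) measurableSet_Iic)
  have hS : ∀ t, {y | t - y ∈ Iic (0 : ℝ)} = Ici t := fun t => by
    ext y
    simp
  refine measure_eq_of_dense_Ici (D := (fun q => c * q) '' {q | m (Ici (c * q)) = m' (Ici (c * q))})
    ?_ ?_
  · refine (mul_left_surjective₀ hc).denseRange.dense_image (by fun_prop) ?_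
    refine Measure.dense_of_ae (μ := volume) ?_
    filter_upwards [h1] with q hq
    simp only [smear, hS, Complex.ofReal_inj] at hq
    exact (measureReal_eq_measureReal_iff).1 hq
  · rintro _ ⟨q, hq, rfl⟩
    exact hq

theorem IsPositionNoise.unique {E : Set ℝ → (L2 ℝ →L[ℂ] L2 ℝ)} {e e' : Measure ℝ}
    (h : IsPositionNoise E e) (h' : IsPositionNoise E e') : e = e' := by
  have := h.1
  have := h'.1
  refine eq_of_posFun_smear_eq one_ne_zero fun X hX => ?_
  simp only [one_mul]
  exact (h.2 X hX).symm.trans (h'.2 X hX)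

theorem posFun_eq_fourierOp_momFun (g : ℝ → ℂ) :
    posFun (fun ξ => g (2 * Real.pi * ξ)) = fourierOp ∘L momFun g ∘L fourierInvOp := by
  ext1 ψ
  have h : ∀ χ : L2 ℝ, fourierOp (fourierInvOp χ) = χ :=
    (Lp.fourierTransformₗᵢ ℝ ℂ).apply_symm_apply
  simp only [momFun, ContinuousLinearMap.comp_apply, h]
  rfl

theorem IsMomentumNoise.unique {F : Set ℝ → (L2 ℝ →L[ℂ] L2 ℝ)} {f f' : Measure ℝ}
    (h : IsMomentumNoise F f) (h' : IsMomentumNoise F f') : f = f' := by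
  have := h.1
  have := h'.1
  refine eq_of_posFun_smear_eq (c := 2 * Real.pi) (by positivity) fun Y hY => ?_
  rw [posFun_eq_fourierOp_momFun, posFun_eq_fourierOp_momFun, ← h.2 Y hY, ← h'.2 Y hY]

/-! ### The uncertainty relation for the noise distributions -/

/-- Cauchy–Schwarz, as Hölder's inequality for the counting measure. -/
theorem tsum_rpow_half_mul_le {ι : Type*} (x y : ι → ℝ≥0∞) :
    ∑' i, x i ^ (1 / 2 : ℝ) * y i ^ (1 / 2 : ℝ) ≤
      (∑' i, x i) ^ (1 / 2 : ℝ) * (∑' i, y i) ^ (1 / 2 : ℝ) := by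
  let _ : MeasurableSpace ι := ⊤
  have h := ENNReal.lintegral_mul_le_Lp_mul_Lq (Measure.count (α := ι))
    (Real.HolderConjugate.two_two) (f := fun i => x i ^ (1 / 2 : ℝ))
    (g := fun i => y i ^ (1 / 2 : ℝ)) (measurable_from_top.aemeasurable)
    (measurable_from_top.aemeasurable)
  have e : ∀ z : ℝ≥0∞, (z ^ (1 / 2 : ℝ)) ^ (2 : ℝ) = z := fun z => by
    rw [← ENNReal.rpow_mul]
    norm_num
  simpa only [lintegral_count, Pi.mul_apply, e] using h

/-- Each unnormalised `φᵢ` contributes `‖φᵢ‖² ≤ 2 √Iᵢ √Jᵢ`; these weights sum to one and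
Cauchy–Schwarz combines the moments. The centres are common to all `i`, so they need not be the
means of `φᵢ`. -/
theorem noise_uncertainty {ι : Type*} {φ : ι → L2 ProbeConf}
    (hφ : HasSum (fun i => ‖φ i‖ ^ 2) 1) {u v : ProbeConf} (huv : |⟪u, v⟫_ℝ| = 1) (a b : ℝ) :
    1 / 4 ≤ (∫⁻ x, ENNReal.ofReal ((x - a) ^ 2) ∂noise φ fun w => ⟪u, w⟫_ℝ) *
      ∫⁻ x, ENNReal.ofReal ((x - b) ^ 2) ∂noise (fun i => fourierOp (φ i))
        fun w => 2 * Real.pi * ⟪v, w⟫_ℝ := by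
  rw [lintegral_noise _ (by fun_prop) (by fun_prop), lintegral_noise _ (by fun_prop) (by fun_prop)]
  have e : ∀ s t : ℝ, (-s - t) ^ 2 = (s + t) ^ 2 := fun s t => by ring
  simp only [e]
  set I := fun i => ∫⁻ w, ENNReal.ofReal ((⟪u, w⟫_ℝ + a) ^ 2) ∂density (φ i) with hI
  set J := fun i => ∫⁻ w, ENNReal.ofReal ((2 * Real.pi * ⟪v, w⟫_ℝ + b) ^ 2)
    ∂density (fourierOp (φ i)) with hJ
  have h1 : (1 : ℝ≥0∞) ≤ 2 * ((∑' i, I i) ^ (1 / 2 : ℝ) * (∑' i, J i) ^ (1 / 2 : ℝ)) := by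
    calc (1 : ℝ≥0∞) = ∑' i, ‖φ i‖ₑ ^ 2 := (tsum_enorm_sq hφ).symm
      _ ≤ ∑' i, 2 * (I i ^ (1 / 2 : ℝ) * J i ^ (1 / 2 : ℝ)) := by
        refine ENNReal.tsum_le_tsum fun i => ?_
        have h := uncertainty (u := u) (v := v) (fun h => by simp [h] at huv) a b (φ i)
        rwa [huv, ENNReal.ofReal_one, one_mul] at h
      _ = 2 * ∑' i, I i ^ (1 / 2 : ℝ) * J i ^ (1 / 2 : ℝ) := ENNReal.tsum_mul_left
      _ ≤ _ := mul_le_mul_right (tsum_rpow_half_mul_le I J) 2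
  have h2 : (1 : ℝ≥0∞) ≤ 4 * ((∑' i, I i) * ∑' i, J i) := by
    have h := pow_le_pow_left₀ zero_le h1 2
    rw [one_pow, mul_pow, mul_pow, ← ENNReal.rpow_natCast (_ ^ _), ← ENNReal.rpow_natCast (_ ^ _),
      ← ENNReal.rpow_mul, ← ENNReal.rpow_mul] at h
    norm_num at h
    exact h
  exact ENNReal.div_le_of_le_mul' h2

/-! ### The operational error of a smeared observable -/

theorem lintegral_ofReal_sq_eq {α : Type*} [MeasurableSpace α] (μ : Measure α) (f : α → ℝ) :
    (∫⁻ x, ENNReal.ofReal (f x ^ 2) ∂μ) ^ (1 / 2 : ℝ) = eLpNorm f 2 μ := by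
  rw [eLpNorm_eq_lintegral_rpow_enorm_toReal two_ne_zero ENNReal.ofNat_ne_top]
  simp only [ENNReal.toReal_ofNat, ENNReal.rpow_ofNat]
  congr 1
  refine lintegral_congr fun x => ?_
  rw [← enorm_pow, Real.enorm_of_nonneg (sq_nonneg _)]

theorem eLpNorm_comp_map {α : Type*} [MeasurableSpace α] {γ : Measure α} {f : α → ℝ}
    (hf : Measurable f) {μ : Measure ℝ} (h : γ.map f = μ) : eLpNorm f 2 γ = eLpNorm id 2 μ := by
  rw [← h, eLpNorm_map_measure aestronglyMeasurable_id hf.aemeasurable]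
  rfl

theorem secondMoment_eq (m : Measure ℝ) : secondMoment m = eLpNorm id 2 m ^ 2 := by
  have h := lintegral_ofReal_sq_eq m id
  rw [← h, ← ENNReal.rpow_natCast, ← ENNReal.rpow_mul]
  simp [secondMoment]

theorem wasserstein_eq (α β : Measure ℝ) : wasserstein α β =
    ⨅ (γ : Measure (ℝ × ℝ)) (_ : γ.map Prod.fst = α ∧ γ.map Prod.snd = β),
      eLpNorm (fun z : ℝ × ℝ => z.1 - z.2) 2 γ := by
  simp only [wasserstein, sq_abs, lintegral_ofReal_sq_eq]

/-- The distribution of `x - y`, where `x` and `y` are independent with distributions `β`, `m`. -/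
def diffLaw (β m : Measure ℝ) : Measure ℝ := (β.prod m).map fun z => z.1 - z.2

theorem wasserstein_diffLaw_le (β m : Measure ℝ) [IsProbabilityMeasure β]
    [IsProbabilityMeasure m] : wasserstein (diffLaw β m) β ≤ eLpNorm id 2 m := by
  rw [wasserstein_eq]
  -- The transport plan uses the same `x` on both sides, pairing `x - y` with `x`; its cost is the
  -- second moment of `y`.
  refine iInf₂_le_of_le ((β.prod m).map fun z => (z.1 - z.2, z.1)) ⟨?_, ?_⟩ (le_of_eq ?_)
  · rw [Measure.map_map measurable_fst (by fun_prop)]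
    rfl
  · rw [Measure.map_map measurable_snd (by fun_prop)]
    exact (Measure.map_fst_prod).trans (by simp)
  · rw [eLpNorm_map_measure (by fun_prop) (by fun_prop)]
    have e : ((fun z : ℝ × ℝ => z.1 - z.2) ∘ fun z : ℝ × ℝ => (z.1 - z.2, z.1)) =
        -(Prod.snd : ℝ × ℝ → ℝ) := by
      funext z
      simp
    rw [e, eLpNorm_neg]
    exact eLpNorm_comp_map measurable_snd (Measure.map_snd_prod.trans (by simp))

/-- Minkowski twice: `y = x - (x - y)` on the product space, then `x - y` against `x` along an
arbitrary transport plan. The loss `2 * eLpNorm id 2 β` is negligible when `β` is concentrated near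
`0`. -/
theorem le_wasserstein_diffLaw (β m : Measure ℝ) [IsProbabilityMeasure β]
    [IsProbabilityMeasure m] :
    eLpNorm id 2 m ≤ wasserstein (diffLaw β m) β + 2 * eLpNorm id 2 β := by
  have h1 : eLpNorm id 2 m ≤ eLpNorm id 2 β + eLpNorm id 2 (diffLaw β m) := by
    have e1 : eLpNorm (Prod.snd : ℝ × ℝ → ℝ) 2 (β.prod m) = eLpNorm id 2 m :=
      eLpNorm_comp_map measurable_snd (Measure.map_snd_prod.trans (by simp))
    have e2 : eLpNorm (Prod.fst : ℝ × ℝ → ℝ) 2 (β.prod m) = eLpNorm id 2 β :=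
      eLpNorm_comp_map measurable_fst (Measure.map_fst_prod.trans (by simp))
    have e3 : eLpNorm (fun z : ℝ × ℝ => z.1 - z.2) 2 (β.prod m) = eLpNorm id 2 (diffLaw β m) :=
      eLpNorm_comp_map (by fun_prop) rfl
    have e4 : (Prod.snd : ℝ × ℝ → ℝ) = Prod.fst - fun z : ℝ × ℝ => z.1 - z.2 := by
      funext z
      simp
    have h := eLpNorm_sub_le (p := 2) (μ := β.prod m) (f := (Prod.fst : ℝ × ℝ → ℝ))
      (g := fun z : ℝ × ℝ => z.1 - z.2) measurable_fst.aestronglyMeasurable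
      (measurable_fst.sub measurable_snd).aestronglyMeasurable one_le_two
    rwa [← e4, e1, e2, e3] at h
  have h2 : eLpNorm id 2 (diffLaw β m) ≤ wasserstein (diffLaw β m) β + eLpNorm id 2 β := by
    rw [wasserstein_eq, ENNReal.iInf_add]
    refine le_iInf fun γ => ?_
    rw [ENNReal.iInf_add]
    refine le_iInf fun hγ => ?_
    rw [← eLpNorm_comp_map measurable_fst hγ.1, ← eLpNorm_comp_map measurable_snd hγ.2]
    have e : (Prod.fst : ℝ × ℝ → ℝ) = (fun z : ℝ × ℝ => z.1 - z.2) + Prod.snd := by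
      funext z
      simp
    conv_lhs => rw [e]
    exact eLpNorm_add_le (by fun_prop) (by fun_prop) one_le_two
  calc eLpNorm id 2 m ≤ eLpNorm id 2 β + (wasserstein (diffLaw β m) β + eLpNorm id 2 β) :=
        h1.trans (add_le_add_right h2 _)
    _ = _ := by ring

theorem diffLaw_sum {ι : Type*} (β : ι → Measure ℝ) (m : Measure ℝ) [SFinite m] :
    diffLaw (Measure.sum β) m = Measure.sum fun i => diffLaw (β i) m := by
  rw [diffLaw, Measure.prod_sum_left, Measure.map_sum (by fun_prop)]
  rfl

/-- In a state `∑ᵢ |φᵢ⟩⟨φᵢ|` the distribution of the outcomes of an observable is the sum of the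
distributions for the vectors `φᵢ`. -/
theorem IsOutcomeLaw.eq_sum {A : Set ℝ → (L2 ℝ →L[ℂ] L2 ℝ)} {ρ : DensityOperator (L2 ℝ)}
    {α : Measure ℝ} (h : IsOutcomeLaw A ρ α) {ι : Type} {φ : ι → L2 ℝ}
    (hφ : HasSum (fun i => ‖φ i‖ ^ 2) 1)
    (hρ : ∀ x, HasSum (fun i => ⟪φ i, x⟫_ℂ • φ i) (ρ.op x)) {D : L2 ℝ → Measure ℝ}
    (hD : ∀ ψ, D ψ univ = ‖ψ‖ₑ ^ 2)
    (hA : ∀ X, MeasurableSet X → ∀ ψ, ⟪ψ, A X ψ⟫_ℂ = ((D ψ).real X : ℂ)) :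
    α = Measure.sum fun i => D (φ i) := by
  have := h.1
  have hfin : ∀ X, ∑' i, D (φ i) X ≠ ∞ := fun X => by
    refine ne_top_of_le_ne_top ENNReal.one_ne_top ?_
    rw [← tsum_enorm_sq hφ]
    exact ENNReal.tsum_le_tsum fun i => (measure_mono (subset_univ X)).trans (hD _).le
  ext X hX
  have h1 := hasSum_trace_conj_comp hφ.summable hρ (ContinuousLinearMap.id ℂ (L2 ℝ)) (A X)
  simp only [ContinuousLinearMap.id_apply, hA X hX] at h1
  have e : (ContinuousLinearMap.id ℂ (L2 ℝ) ∘L ρ.op ∘L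
      (ContinuousLinearMap.id ℂ (L2 ℝ)).adjoint) ∘L A X = ρ.op ∘L A X := by
    rw [ContinuousLinearMap.adjoint_id]
    rfl
  rw [e, h.2 X hX, Complex.hasSum_ofReal] at h1
  rw [Measure.sum_apply _ hX, ← ENNReal.toReal_eq_toReal_iff' (measure_ne_top _ _) (hfin X),
    ENNReal.tsum_toReal_eq fun i => ENNReal.ne_top_of_tsum_ne_top (hfin X) i]
  exact h1.tsum_eq.symm

theorem diffLaw_univ (β m : Measure ℝ) [IsProbabilityMeasure m] :
    diffLaw β m univ = β univ := by
  rw [diffLaw, Measure.map_apply (by fun_prop) .univ, preimage_univ, ← univ_prod_univ,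
    Measure.prod_prod, measure_univ (μ := m), mul_one]

/-- If the outcomes of `A` are those of `B` with an added independent noise of distribution `m`
and `B` can have outcomes concentrated near `0`, then the error of `A` as an approximation of `B`
is the root of the second moment of `m`. -/
theorem observableError_eq {A B : Set ℝ → (L2 ℝ →L[ℂ] L2 ℝ)} {m : Measure ℝ}
    [IsProbabilityMeasure m] {D : L2 ℝ → Measure ℝ} (hD : ∀ ψ, D ψ univ = ‖ψ‖ₑ ^ 2)
    (hA : ∀ X, MeasurableSet X → ∀ ψ, ⟪ψ, A X ψ⟫_ℂ = ((diffLaw (D ψ) m).real X : ℂ))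
    (hB : ∀ X, MeasurableSet X → ∀ ψ, ⟪ψ, B X ψ⟫_ℂ = ((D ψ).real X : ℂ))
    (hconc : ∀ ε : ℝ, 0 < ε → ∃ ψ, ‖ψ‖ = 1 ∧ ∀ᵐ x ∂D ψ, ‖x‖ ≤ ε) :
    observableError A B = eLpNorm id 2 m := by
  refine le_antisymm ?_ ?_
  · refine iSup_le fun ρ => iSup_le fun α => iSup_le fun β => iSup_le fun h => ?_
    obtain ⟨ι, _, φ, hφ, hρ⟩ := ρ.exists_countable_hasSum
    have hβ := h.2.eq_sum hφ hρ hD hB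
    have hα := h.1.eq_sum hφ hρ (D := fun ψ => diffLaw (D ψ) m)
      (fun ψ => (diffLaw_univ _ m).trans (hD ψ)) hA
    rw [← diffLaw_sum, ← hβ] at hα
    have := h.2.1
    rw [hα]
    exact wasserstein_diffLaw_le β m
  · refine ENNReal.le_of_forall_pos_le_add fun ε hε _ => ?_
    -- The lower bound loses twice the root mean square of the ideal outcomes, hence `ε / 2`.
    obtain ⟨ψ, hψ, hc⟩ := hconc (ε / 2) (by positivity)
    have hp : IsProbabilityMeasure (D ψ) := ⟨by rw [hD, ← ofReal_norm, hψ]; simp⟩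
    have hp' : IsProbabilityMeasure (diffLaw (D ψ) m) := ⟨by rw [diffLaw_univ, measure_univ]⟩
    have hle : wasserstein (diffLaw (D ψ) m) (D ψ) ≤ observableError A B := by
      refine le_iSup_of_le (pureState ψ hψ) (le_iSup_of_le (diffLaw (D ψ) m)
        (le_iSup_of_le (D ψ) (le_iSup_of_le ⟨⟨hp', fun X hX => ?_⟩, ⟨hp, fun X hX => ?_⟩⟩ le_rfl)))
      · rw [trace_pureState_comp, hA X hX]
      · rw [trace_pureState_comp, hB X hX]
    refine (le_wasserstein_diffLaw (D ψ) m).trans (add_le_add hle ?_)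
    have h1 := eLpNorm_le_of_ae_bound (f := (id : ℝ → ℝ)) (p := 2) hc
    rw [measure_univ, ENNReal.one_rpow, one_mul] at h1
    refine (mul_le_mul_right h1 2).trans (le_of_eq ?_)
    rw [← ENNReal.ofReal_ofNat 2, ← ENNReal.ofReal_mul zero_le_two, mul_div_cancel₀ _ two_ne_zero,
      ENNReal.ofReal_coe_nnreal]

theorem exists_unit_concentrated {δ : ℝ} (hδ : 0 < δ) :
    ∃ χ : L2 ℝ, ‖χ‖ = 1 ∧ ∀ᵐ x ∂density χ, |x| ≤ δ := by
  have hfin : volume (Icc (-δ) δ) ≠ ∞ := by simp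
  set χ : L2 ℝ := indicatorConstLp 2 measurableSet_Icc hfin (1 : ℂ) with hχ
  have hn : ‖χ‖ ≠ 0 := by
    rw [hχ, norm_indicatorConstLp two_ne_zero ENNReal.ofNat_ne_top, Measure.real, Real.volume_Icc,
      ENNReal.toReal_ofReal (by linarith), norm_one, one_mul]
    exact (Real.rpow_pos_of_pos (by linarith) _).ne'
  refine ⟨((‖χ‖⁻¹ : ℝ) : ℂ) • χ, ?_, ?_⟩
  · rw [norm_smul, Complex.norm_real, norm_inv, norm_norm, inv_mul_cancel₀ hn]
  · rw [density, ae_withDensity_iff' (aemeasurable_enorm_sq _)]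
    filter_upwards [Lp.coeFn_smul ((‖χ‖⁻¹ : ℝ) : ℂ) χ,
      indicatorConstLp_coeFn_notMem (p := 2) (hs := measurableSet_Icc) (hμs := hfin) (c := (1 : ℂ))]
      with x h1 h2 h3
    by_contra hx
    refine h3 ?_
    rw [h1, Pi.smul_apply, hχ, h2 fun h => hx (abs_le.2 h)]
    simp

theorem inner_posFun_smear_mul (m : Measure ℝ) [IsProbabilityMeasure m] (c : ℝ) {X : Set ℝ}
    (hX : MeasurableSet X) (χ : L2 ℝ) :
    ⟪χ, posFun (fun q => smear m X (c * q)) χ⟫_ℂ =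
      ((diffLaw ((density χ).map fun q => c * q) m).real X : ℂ) := by
  have h : MeasurableSet ((fun z : ℝ × ℝ => z.1 - z.2) ⁻¹' X) :=
    measurableSet_preimage (by fun_prop) hX
  rw [inner_posFun_smear m c hX, Measure.real, diffLaw, Measure.map_apply (by fun_prop) hX,
    Measure.prod_apply h, lintegral_map (measurable_measure_prodMk_left h) (by fun_prop)]
  rfl

theorem inner_posFun_chi_mul (c : ℝ) {X : Set ℝ} (hX : MeasurableSet X) (χ : L2 ℝ) :
    ⟪χ, posFun (fun q => chi X (c * q)) χ⟫_ℂ =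
      (((density χ).map fun q => c * q).real X : ℂ) := by
  rw [Measure.real, Measure.map_apply (by fun_prop) hX]
  exact inner_posFun_chi (A := (fun q => c * q) ⁻¹' X) (measurableSet_preimage (by fun_prop) hX) χ

theorem map_density_univ (c : ℝ) (χ : L2 ℝ) :
    ((density χ).map fun q => c * q) univ = ‖χ‖ₑ ^ 2 := by
  rw [Measure.map_apply (by fun_prop) .univ, preimage_univ, density_univ]

theorem exists_unit_map_concentrated {c : ℝ} (hc : 0 < c) {ε : ℝ} (hε : 0 < ε) :
    ∃ χ : L2 ℝ, ‖χ‖ = 1 ∧ ∀ᵐ x ∂(density χ).map fun q => c * q, ‖x‖ ≤ ε := by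
  obtain ⟨χ, h1, h2⟩ := exists_unit_concentrated (div_pos hε hc)
  refine ⟨χ, h1, ?_⟩
  rw [ae_map_iff (by fun_prop) (measurableSet_le (by fun_prop) (by fun_prop))]
  filter_upwards [h2] with x hx
  rw [norm_mul, Real.norm_eq_abs, Real.norm_eq_abs, abs_of_pos hc, mul_comm]
  exact (le_div_iff₀ hc).1 hx

theorem IsPositionNoise.observableError_sq {E : Set ℝ → (L2 ℝ →L[ℂ] L2 ℝ)} {e : Measure ℝ}
    (h : IsPositionNoise E e) : observableError E idealPosition ^ 2 = secondMoment e := by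
  have := h.1
  rw [secondMoment_eq, observableError_eq (A := E) (B := idealPosition) (m := e)
    (D := fun ψ => (density ψ).map fun q => 1 * q) (map_density_univ 1)
    (fun X hX ψ => ?_) (fun X hX ψ => ?_) fun ε hε => exists_unit_map_concentrated one_pos hε]
  · rw [← inner_posFun_smear_mul e 1 hX, h.2 X hX]
    simp only [one_mul]
  · rw [← inner_posFun_chi_mul 1 hX, idealPosition]
    simp only [one_mul]

theorem IsMomentumNoise.observableError_sq {F : Set ℝ → (L2 ℝ →L[ℂ] L2 ℝ)} {f : Measure ℝ}
    (h : IsMomentumNoise F f) : observableError F idealMomentum ^ 2 = secondMoment f := by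
  have := h.1
  have hn : ∀ ψ : L2 ℝ, ‖fourierOp ψ‖ = ‖ψ‖ := (Lp.fourierTransformₗᵢ ℝ ℂ).norm_map
  rw [secondMoment_eq, observableError_eq (A := F) (B := idealMomentum) (m := f)
    (D := fun ψ => (density (fourierOp ψ)).map fun q => 2 * Real.pi * q) (fun ψ => ?_)
    (fun X hX ψ => ?_) (fun X hX ψ => ?_) fun ε hε => ?_]
  · rw [map_density_univ, ← ofReal_norm, hn, ofReal_norm]
  · rw [← inner_posFun_smear_mul f _ hX, h.2 X hX, inner_momFun]
    rfl
  · rw [← inner_posFun_chi_mul _ hX, idealMomentum, inner_momFun]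
    rfl
  -- Momentum-concentrated states are inverse Fourier transforms of position-concentrated ones.
  · obtain ⟨χ, h1, h2⟩ := exists_unit_map_concentrated (c := 2 * Real.pi) (by positivity) hε
    have hF : fourierOp (fourierInvOp χ) = χ := (Lp.fourierTransformₗᵢ ℝ ℂ).apply_symm_apply χ
    exact ⟨fourierInvOp χ, by rw [← hn, hF, h1], by rw [hF]; exact h2⟩

end ArthursKelly

end

theorem mainTheorem3 (lam mu kap : ℝ) (hlam : 0 < lam) (hmu : 0 < mu)
    (σ : ArthursKelly.DensityOperator (ArthursKelly.L2 ArthursKelly.ProbeConf)) :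
    (∃ G, ArthursKelly.IsEffectiveObservable lam mu kap σ G) ∧
    ∀ G, ArthursKelly.IsEffectiveObservable lam mu kap σ G →
      (∃ e, ArthursKelly.IsPositionNoise (fun X => G X Set.univ) e) ∧
      (∃ f, ArthursKelly.IsMomentumNoise (fun Y => G Set.univ Y) f) ∧
      ∀ e f : MeasureTheory.Measure ℝ,
        ArthursKelly.IsPositionNoise (fun X => G X Set.univ) e →
        ArthursKelly.IsMomentumNoise (fun Y => G Set.univ Y) f →
        1 / 4 ≤ ProbabilityTheory.evariance id e * ProbabilityTheory.evariance id f ∧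
        1 / 4 ≤ ArthursKelly.secondMoment e * ArthursKelly.secondMoment f ∧
        ArthursKelly.observableError (fun X => G X Set.univ) ArthursKelly.idealPosition ^ 2
          = ArthursKelly.secondMoment e ∧
        ArthursKelly.observableError (fun Y => G Set.univ Y) ArthursKelly.idealMomentum ^ 2
          = ArthursKelly.secondMoment f ∧
        1 / 2 ≤ ArthursKelly.observableError (fun X => G X Set.univ) ArthursKelly.idealPosition *
          ArthursKelly.observableError (fun Y => G Set.univ Y) ArthursKelly.idealMomentum := by
  refine ⟨ArthursKelly.exists_isEffectiveObservable lam mu kap σ, fun G hG => ?_⟩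
  obtain ⟨ι, _, φ, hφ, hσ⟩ := σ.exists_countable_hasSum
  have he₀ := ArthursKelly.isPositionNoise_noise kap hlam hmu hφ hσ hG
  have hf₀ := ArthursKelly.isMomentumNoise_noise kap hlam hmu hφ hσ hG
  refine ⟨⟨_, he₀⟩, ⟨_, hf₀⟩, fun e f he hf => ?_⟩
  have key : ∀ a b : ℝ, 1 / 4 ≤ (∫⁻ x, ENNReal.ofReal ((x - a) ^ 2) ∂e) *
      ∫⁻ x, ENNReal.ofReal ((x - b) ^ 2) ∂f := fun a b => by
    rw [he.unique he₀, hf.unique hf₀]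
    refine ArthursKelly.noise_uncertainty hφ ?_ a b
    rw [ArthursKelly.inner_noisePosVec_noiseMomVec kap hlam hmu, abs_neg, abs_one]
  have hm : 1 / 4 ≤ ArthursKelly.secondMoment e * ArthursKelly.secondMoment f := by
    simpa only [ArthursKelly.secondMoment, sub_zero] using key 0 0
  refine ⟨?_, hm, he.observableError_sq, hf.observableError_sq, ?_⟩
  -- The centre in `evariance` is the Bochner mean, which is `0` by default if `id` is not
  -- integrable; `key` holds for every real centre and covers that case.
  · rw [ProbabilityTheory.evariance_eq_lintegral_ofReal,
      ProbabilityTheory.evariance_eq_lintegral_ofReal]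
    exact key _ _
  · rw [← ENNReal.pow_le_pow_left_iff two_ne_zero, mul_pow, he.observableError_sq,
      hf.observableError_sq]
    refine le_trans (le_of_eq ?_) hm
    rw [one_div, one_div, ← ENNReal.inv_pow]
    norm_num
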